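/- Let $\mathbb K=\mathbb R$ or $\mathbb C$, let $\Omega$ be a non-empty set and let $(\mathcal F,\tau)$ be a bornological locally convex Hausdorff space whose underlying vector space $\mathcal F$ is a linear space of $\mathbb K$-valued functions on $\Omega$. Notation. For a locally convex Hausdorff space $Y$, $Y'$ is its topological dual and $Y_b'$ is $Y'$ with the topology of uniform convergence on bounded sets. $\tau_{\mathrm p}$ is the topology of pointwise convergence on $\mathcal F$, and $\delta_x(f):=f(x)$ for $x\in\Omega$, $f\in\mathcal F$. For topologies on $\mathcal F$, $\tau_0\le\tau_1$ means that $\tau_0$ is coarser than $\tau_1$. A space is *completely normable* if its topology is induced by a complete norm. It is *semi-reflexive* if the evaluation map $X\to (X_b')'$ is surjective, and *semi-Montel* if all its bounded sets are relatively compact. For a norm $p$, $B_p$ is its closed unit ball. For a locally convex Hausdorff topology $\widetilde\tau$ on $\mathcal F$ we say that $(\mathcal F,\tau)$ satisfies * (BBC) [resp. (BBCl)] for $\widetilde\tau$ if every $\tau$-bounded set is contained in an absolutely convex $\tau$-bounded $\widetilde\tau$-compact [resp. $\widetilde\tau$-closed] set; * (CNC) for $\widetilde\tau$ if $\tau$ has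 a basis of neighbourhoods of $0$ consisting of absolutely convex $\widetilde\tau$-closed sets. $\mathcal F_{\mathcal B,\widetilde\tau}'$ is the space of all linear functionals on $\mathcal F$ whose restriction to each $\tau$-bounded set is $\widetilde\tau$-continuous. If the $\tau$-bounded sets have a countable basis $(B_n)_{n\in\mathbb N}$ of non-empty absolutely convex $\widetilde\tau$-closed sets with $2B_n\subset B_{n+1}$ for all $n$, the *mixed topology* $\gamma=\gamma(\tau,\widetilde\tau)$ is the locally convex Hausdorff topology that has as a basis of neighbourhoods of $0$ the sets $\bigcup_{n\ge1}\sum_{k=1}^n(U_k\cap B_k)$, where $(U_k)$ runs through the sequences of absolutely convex $\widetilde\tau$-neighbourhoods of $0$; it does not depend on the choice of $(B_n)$. Such $(B_n)$ exist in the situations (c) and (d) below. Then the following assertions are equivalent. (a) $(\mathcal F,\tau)$ admits a strong Banach linearisation: there are a completely normable locally convex Hausdorff space $Y$ over $\mathbb K$, a map $\delta\colon\Omega\to Y$ and a topological isomorphism $T\colon(\mathcal F,\tau)\to Y_b'$ with $T(f)\circ\delta=f$ for all $f\in\mathcal F$. (b) There are a semi-Montel locally convex Hausdorff space $Y$ over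 $\mathbb K$ and a topological isomorphism $\varphi\colon(\mathcal F,\tau)\to(Y_b')_b'$ (a semi-Montel prebidual) such that $Y_b'$ is completely normable and for every $x\in\Omega$ there is a unique $y_x'\in Y'$ with $\delta_x=\varphi(\cdot)(y_x')$. (c) $(\mathcal F,\tau)$ is completely normable and satisfies (BBC) and (CNC) for some locally convex Hausdorff topology $\widetilde\tau$ with $\tau_{\mathrm p}\le\widetilde\tau$ such that $(\mathcal F,\tau)$ and $(\mathcal F,\gamma)$ have the same bounded sets. (d) $(\mathcal F,\tau)$ is completely normable and satisfies (BBCl) for some locally convex Hausdorff topology $\widetilde\tau$ with $\tau_{\mathrm p}\le\widetilde\tau\le\tau$ such that $(\mathcal F,\gamma)$ is semi-reflexive. (e) $(\mathcal F,\tau)$ is completely normable and satisfies (BBC) for some locally convex Hausdorff topology $\widetilde\tau$ with $\tau_{\mathrm p}\le\widetilde\tau$. (f) There are a norm $p$ on $\mathcal F$ which induces $\tau$ and a locally convex Hausdorff topology $\widetilde\tau$ on $\mathcal F$ with $\tau_{\mathrm p}\le\widetilde\tau$ such that $B_p$ is $\widetilde\tau$-compact. (g) There are a norm $p$ on $\mathcal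 F$ which induces $\tau$ and a locally convex Hausdorff topology $\widetilde\tau$ on $\mathcal F$ such that $B_p$ is $\widetilde\tau$-compact and $\delta_x\in\mathcal F_{\mathcal B,\widetilde\tau}'$ for all $x\in\Omega$. (h) $(\mathcal F,\tau)$ is completely normable and satisfies (BBC) for $\tau_{\mathrm p}$. (i) There is a norm $p$ on $\mathcal F$ which induces $\tau$ such that $B_p$ is $\tau_{\mathrm p}$-compact. -/

import Mathlib

open Topology Filter Bornology
open scoped Pointwise ComplexOrder

/-!
Conventions. Several topologies on one vector space `X` are compared, so topologies on `X` are
passed as explicit arguments. In Mathlib's order on topologies `t ≤ s` says that `t` is FINER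
than `s`; hence "`τ₀` is coarser than `τ₁`" is written `τ₁ ≤ τ₀`. The scalar field `𝕜` is `ℝ` or `ℂ`
(`RCLike 𝕜`), absolute convexity is Mathlib's `AbsConvex 𝕜`, and the strong dual `Y'_b` is Mathlib's
`StrongDual 𝕜 Y`, whose topology is that of uniform convergence on bounded sets.
-/

namespace Linearisation

universe u v w w'

section General

variable (𝕜 : Type v) [RCLike 𝕜] {X : Type w} [AddCommGroup X] [Module 𝕜 X]

/-- `τ` is a locally convex Hausdorff (vector space) topology on `X`. -/
structure IsLCH (τ : TopologicalSpace X) : Prop where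
  polynormable : @PolynormableSpace 𝕜 X _ _ _ τ
  t2 : @T2Space X τ

/-- `B` is a bounded subset of `(X, τ)`. -/
def IsBdd (τ : TopologicalSpace X) (B : Set X) : Prop :=
  @IsVonNBounded 𝕜 X _ _ _ τ B

/-- `(X, τ)` is bornological: every absolutely convex set that absorbs all bounded sets is a
neighbourhood of zero. -/
def IsBornologicalSpace (τ : TopologicalSpace X) : Prop :=
  ∀ U : Set X, AbsConvex 𝕜 U → (∀ B : Set X, IsBdd 𝕜 τ B → Absorbs 𝕜 U B) → U ∈ @nhds X τ 0

variable {𝕜} in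
/-- The seminorm `p` is a norm and it induces the topology `τ`. -/
structure IsNormInducing (τ : TopologicalSpace X) (p : Seminorm 𝕜 X) : Prop where
  eq_zero : ∀ x, p x = 0 → x = 0
  induces : @WithSeminorms 𝕜 X Unit _ _ _ (fun _ => p) τ

/-- `(X, τ)` is completely normable: `τ` is induced by a norm for which `X` is complete. -/
def CompletelyNormable (τ : TopologicalSpace X) : Prop :=
  ∃ p : Seminorm 𝕜 X, IsNormInducing τ p ∧
    ∀ s : ℕ → X, (∀ ε > 0, ∃ N, ∀ m ≥ N, ∀ n ≥ N, p (s m - s n) < ε) →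
      ∃ x, Tendsto (fun n => p (s n - x)) atTop (𝓝 0)

/-- Condition (BBC) for `τ'`: every `τ`-bounded set is contained in an absolutely convex
`τ`-bounded `τ'`-compact set. -/
def BBC (τ τ' : TopologicalSpace X) : Prop :=
  ∀ B : Set X, IsBdd 𝕜 τ B →
    ∃ C : Set X, B ⊆ C ∧ AbsConvex 𝕜 C ∧ IsBdd 𝕜 τ C ∧ @IsCompact X τ' C

/-- Condition (BBCl) for `τ'`: every `τ`-bounded set is contained in an absolutely convex
`τ`-bounded `τ'`-closed set. -/
def BBCl (τ τ' : TopologicalSpace X) : Prop :=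
  ∀ B : Set X, IsBdd 𝕜 τ B →
    ∃ C : Set X, B ⊆ C ∧ AbsConvex 𝕜 C ∧ IsBdd 𝕜 τ C ∧ IsClosed[τ'] C

/-- Condition (CNC) for `τ'`: `τ` has a basis of neighbourhoods of zero consisting of absolutely
convex `τ'`-closed sets. -/
def CNC (τ τ' : TopologicalSpace X) : Prop :=
  ∀ U ∈ @nhds X τ 0, ∃ V ∈ @nhds X τ 0, V ⊆ U ∧ AbsConvex 𝕜 V ∧ IsClosed[τ'] V

/-- `(Bₙ)` is a countable basis of the `τ`-bounded sets consisting of (non-empty) absolutely convex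
`τ'`-closed sets with `2 Bₙ ⊆ Bₙ₊₁`. -/
structure IsMixedBasis (τ τ' : TopologicalSpace X) (B : ℕ → Set X) : Prop where
  nonempty : ∀ n, (B n).Nonempty
  absConvex : ∀ n, AbsConvex 𝕜 (B n)
  bdd : ∀ n, IsBdd 𝕜 τ (B n)
  closed : ∀ n, IsClosed[τ'] (B n)
  basis : ∀ C : Set X, IsBdd 𝕜 τ C → ∃ n, C ⊆ B n
  two_smul : ∀ n, (2 : 𝕜) • B n ⊆ B (n + 1)

/-- `(Uₙ)` is a sequence of absolutely convex neighbourhoods of zero in `(X, τ')`. -/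
def IsNhdSeq (τ' : TopologicalSpace X) (U : ℕ → Set X) : Prop :=
  ∀ n, AbsConvex 𝕜 (U n) ∧ U n ∈ @nhds X τ' 0

/-- The set `⋃ₙ ∑_{k ≤ n} (U_k ∩ B_k)`. -/
def mixedSet (U B : ℕ → Set X) : Set X :=
  ⋃ n : ℕ, ∑ k ∈ Finset.range (n + 1), (U k ∩ B k)

theorem mixedSet_mono {U U' B : ℕ → Set X} (h : ∀ k, U k ⊆ U' k) :
    mixedSet U B ⊆ mixedSet U' B :=
  Set.iUnion_mono fun _ => Set.finsetSum_subset_finsetSum _ _ _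
    fun k _ => Set.inter_subset_inter_left _ (h k)

/-- The mixed topology `γ(τ, τ')`, whose neighbourhoods of zero have the sets `mixedSet U B` as a
basis, where `B` is any basis of the `τ`-bounded sets as in `IsMixedBasis` and `U` runs through the
sequences of absolutely convex neighbourhoods of zero of `τ'`. The topology does not depend on the
choice of `B`; it is only used where such a `B` exists (for instance, whenever `τ` is normable and
(BBCl) holds for `τ'`). -/
@[reducible]
def mixedTopology (τ τ' : TopologicalSpace X) : TopologicalSpace X where
  IsOpen s := ∀ B : ℕ → Set X, IsMixedBasis 𝕜 τ τ' B →
    ∀ x ∈ s, ∃ U : ℕ → Set X, IsNhdSeq 𝕜 τ' U ∧ x +ᵥ mixedSet U B ⊆ s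
  isOpen_univ := fun _ _ _ _ =>
    ⟨fun _ => Set.univ, fun _ => ⟨AbsConvex.univ, Filter.univ_mem⟩, Set.subset_univ _⟩
  isOpen_inter := by
    intro s t hs ht B hB x hx
    obtain ⟨U, hU, hUs⟩ := hs B hB x hx.1
    obtain ⟨V, hV, hVt⟩ := ht B hB x hx.2
    refine ⟨fun n => U n ∩ V n, fun n => ⟨(hU n).1.inter (hV n).1,
      Filter.inter_mem (hU n).2 (hV n).2⟩, Set.subset_inter ?_ ?_⟩
    · exact (Set.vadd_set_mono (mixedSet_mono fun k => Set.inter_subset_left)).trans hUs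
    · exact (Set.vadd_set_mono (mixedSet_mono fun k => Set.inter_subset_right)).trans hVt
  isOpen_sUnion := by
    intro S hS B hB x hx
    obtain ⟨s, hsS, hxs⟩ := hx
    obtain ⟨U, hU, hUs⟩ := hS s hsS B hB x hxs
    exact ⟨U, hU, hUs.trans (Set.subset_sUnion_of_mem hsS)⟩

/-- Condition (BτBγ): `(X, τ)` and `(X, γ)` have the same bounded sets. -/
def SameBounded (τ γ : TopologicalSpace X) : Prop :=
  ∀ B : Set X, IsBdd 𝕜 τ B ↔ IsBdd 𝕜 γ B

/-- `(X, γ)` is semi-reflexive: the evaluation map `X → (X'_b)'` is surjective. -/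
def SemiReflexive (γ : TopologicalSpace X) : Prop :=
  letI := γ
  ∀ φ : StrongDual 𝕜 (StrongDual 𝕜 X), ∃ x : X, ∀ f : StrongDual 𝕜 X, φ f = f x

/-- `(X, σ)` is a semi-Montel space: every bounded set is relatively compact. -/
def SemiMontel (σ : TopologicalSpace X) : Prop :=
  ∀ B : Set X, IsBdd 𝕜 σ B → @IsCompact X σ (@closure X σ B)

/-- Membership of a linear functional in `X'_{𝓑,τ'}`: its restriction to each `τ`-bounded set is
`τ'`-continuous. -/
def MemBddDual (τ τ' : TopologicalSpace X) (ℓ : X →ₗ[𝕜] 𝕜) : Prop :=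
  ∀ B : Set X, IsBdd 𝕜 τ B → @ContinuousOn X 𝕜 τ' _ ℓ B

variable {𝕜} in
/-- The linear bijection `T : (X, τ) → Z` is a topological isomorphism. -/
def IsTopIso (τ : TopologicalSpace X) {Z : Type w'} [AddCommMonoid Z] [Module 𝕜 Z]
    [σ : TopologicalSpace Z] (T : X ≃ₗ[𝕜] Z) : Prop :=
  Continuous[τ, σ] T ∧ Continuous[σ, τ] T.symm

end General

section Function

variable {𝕜 : Type v} [RCLike 𝕜] {Ω : Type u} (F : Submodule 𝕜 (Ω → 𝕜))

/-- The topology of pointwise convergence on the function space `F`. -/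
@[reducible]
def pointwiseTopology : TopologicalSpace F :=
  TopologicalSpace.induced (fun f : F => (f : Ω → 𝕜)) Pi.topologicalSpace

/-- The point evaluation `δ_x : F → 𝕜`. -/
def pointEval (x : Ω) : F →ₗ[𝕜] 𝕜 := (LinearMap.proj x).comp F.subtype

/-- `(δ, Y, T)` is a strong linearisation of `(F, τ)`: `T : (F, τ) → Y'_b` is a topological
isomorphism with `T f ∘ δ = f` for all `f`. -/
def IsStrongLinearisation (τ : TopologicalSpace F) {Y : Type w} [AddCommGroup Y] [Module 𝕜 Y]
    [TopologicalSpace Y] (δ : Ω → Y) (T : F ≃ₗ[𝕜] StrongDual 𝕜 Y) : Prop :=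
  IsTopIso τ T ∧ ∀ f : F, (T f : Y → 𝕜) ∘ δ = (f : Ω → 𝕜)

/-- `(F, τ)` admits a strong Banach linearisation: a strong linearisation `(δ, Y, T)` with a
completely normable locally convex Hausdorff space `Y`. -/
def AdmitsStrongBanachLinearisation (τ : TopologicalSpace F) : Prop :=
  ∃ (Y : Type (max u v)) (_ : AddCommGroup Y) (_ : Module 𝕜 Y) (σ : TopologicalSpace Y),
    IsLCH 𝕜 σ ∧ CompletelyNormable 𝕜 σ ∧
      ∃ (δ : Ω → Y) (T : F ≃ₗ[𝕜] StrongDual 𝕜 Y), IsStrongLinearisation F τ δ T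

/-- `(F, τ)` has a semi-Montel prebidual `(Y, φ)`, that is, `φ : (F, τ) → (Y'_b)'_b` is a topological
isomorphism, such that `Y'_b` is completely normable and for every `x` there is a unique `y'` in `Y'`
with `δ_x = φ(·)(y')`. -/
def HasSemiMontelPrebidualWithEvaluations (τ : TopologicalSpace F) : Prop :=
  ∃ (Y : Type (max u v)) (_ : AddCommGroup Y) (_ : Module 𝕜 Y) (σ : TopologicalSpace Y),
    IsLCH 𝕜 σ ∧ SemiMontel 𝕜 σ ∧
      CompletelyNormable 𝕜 (inferInstance : TopologicalSpace (StrongDual 𝕜 Y)) ∧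
      ∃ φ : F ≃ₗ[𝕜] StrongDual 𝕜 (StrongDual 𝕜 Y), IsTopIso τ φ ∧
        ∀ x : Ω, ∃! y' : StrongDual 𝕜 Y, ∀ f : F, pointEval F x f = φ f y'

end Function

end Linearisation

/-!
Everything reduces to (i), a norm `p` inducing `τ` whose unit ball is compact for pointwise
convergence. Given any topology `τ'` that is coarser than `τ` and makes the unit ball of `p`
compact, the mixed topology `γ(τ, τ')` is the one generated by all seminorms that are
`τ'`-continuous at zero along every `τ`-bounded set. It coincides with `τ'` on `τ`-bounded sets
and, because `p` is the supremum of the `τ'`-continuous functionals that it dominates, it has the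
same bounded sets as `τ`. So `(F, γ)` is a semi-Montel space whose strong dual is a Banach space
for the dual norm of `p`, and Hahn–Banach separation in finitely many coordinates together with
compactness of the unit ball identifies `(F, τ)` with the strong bidual of `(F, γ)`; the dual of
`(F, γ)` is the Banach predual of (a). Conversely, a predual gives (i) by the Banach–Alaoglu
argument, and under (BBC) or (BBCl) the gauge of an absolutely convex set around a norm ball is an
equivalent norm with that set as its unit ball.
-/

namespace Linearisation

universe u v w

section AbsConvex

variable {𝕜 : Type v} [RCLike 𝕜] {X : Type w} [AddCommGroup X] [Module 𝕜 X]

theorem absConvex_image {Y : Type*} [AddCommGroup Y] [Module 𝕜 Y] {C : Set X}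
    (hC : AbsConvex 𝕜 C) (T : X →ₗ[𝕜] Y) : AbsConvex 𝕜 (T '' C) := by
  refine ⟨?_, hC.2.linear_image T⟩
  rintro a ha _ ⟨_, ⟨x, hx, rfl⟩, rfl⟩
  exact ⟨a • x, hC.1.smul_mem ha hx, map_smul T a x⟩

theorem absConvex_seminorm_ball (q : Seminorm 𝕜 X) (r : ℝ) : AbsConvex 𝕜 (q.ball 0 r) := by
  let : Module ℝ X := .restrictScalars ℝ 𝕜 X
  have : IsScalarTower ℝ 𝕜 X := .restrictScalars _ _ _
  exact ⟨q.balanced_ball_zero r, convex_RCLike_iff_convex_real.2 (q.convex_ball 0 r)⟩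

theorem absConvex_seminorm_closedBall (q : Seminorm 𝕜 X) (r : ℝ) :
    AbsConvex 𝕜 (q.closedBall 0 r) := by
  let : Module ℝ X := .restrictScalars ℝ 𝕜 X
  have : IsScalarTower ℝ 𝕜 X := .restrictScalars _ _ _
  exact ⟨q.balanced_closedBall_zero r, convex_RCLike_iff_convex_real.2 (q.convex_closedBall 0 r)⟩

theorem exists_seminorm_ball_subset_subset_closedBall {C : Set X} (hC : AbsConvex 𝕜 C)
    (habs : Absorbent 𝕜 C) : ∃ q : Seminorm 𝕜 X, q.ball 0 1 ⊆ C ∧ C ⊆ q.closedBall 0 1 := by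
  let : Module ℝ X := .restrictScalars ℝ 𝕜 X
  have : IsScalarTower ℝ 𝕜 X := .restrictScalars _ _ _
  have hconv : Convex ℝ C := convex_RCLike_iff_convex_real.1 hC.2
  have hreal : Absorbent ℝ C := fun x => (habs x).restrict_scalars <|
    (tendsto_algebraMap_cobounded ℝ 𝕜).congr Algebra.algebraMap_eq_smul_one
  refine ⟨gaugeSeminorm hC.1 hconv hreal, fun x hx => ?_, fun x hx => ?_⟩
  · exact setOfPred_gauge_lt_one_subset_self hconv habs.zero_mem hreal (by simpa using hx)
  · simpa using gauge_le_one_of_mem hx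

theorem exists_seminorm_closedBall_eq [TopologicalSpace X] [ContinuousSMul 𝕜 X] {C : Set X}
    (hC : AbsConvex 𝕜 C) (habs : Absorbent 𝕜 C) (hcl : IsClosed C) :
    ∃ q : Seminorm 𝕜 X, q.closedBall 0 1 = C := by
  obtain ⟨q, hball, hclosedBall⟩ := exists_seminorm_ball_subset_subset_closedBall hC habs
  refine ⟨q, Set.Subset.antisymm (fun x hx => ?_) hclosedBall⟩
  rw [Seminorm.mem_closedBall_zero] at hx
  have hlim : Tendsto (fun t : ℝ => (t : 𝕜) • x) (𝓝[<] 1) (𝓝 x) := by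
    have hcont : Continuous fun t : ℝ => (t : 𝕜) • x :=
      RCLike.continuous_ofReal.smul continuous_const
    simpa using (hcont.tendsto 1).mono_left nhdsWithin_le_nhds
  refine hcl.mem_of_tendsto hlim ?_
  filter_upwards [Ioo_mem_nhdsLT (zero_lt_one' ℝ)] with t ⟨ht0, ht1⟩
  refine hball ?_
  rw [Seminorm.mem_ball_zero, map_smul_eq_mul, RCLike.norm_ofReal, abs_of_pos ht0]
  exact (mul_le_of_le_one_right ht0.le hx).trans_lt ht1

theorem inv_smul_mem_closedBall (p : Seminorm 𝕜 X) {r : ℝ} (hr : 0 < r) {x : X} (hx : p x ≤ r) :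
    ((r⁻¹ : ℝ) : 𝕜) • x ∈ p.closedBall 0 1 := by
  rw [Seminorm.mem_closedBall_zero, map_smul_eq_mul, RCLike.norm_ofReal,
    abs_of_pos (inv_pos.2 hr), inv_mul_le_iff₀ hr, mul_one]
  exact hx

theorem seminorm_le_mul_of_closedBall {p q : Seminorm 𝕜 X} {M : ℝ}
    (h : ∀ x ∈ p.closedBall 0 1, q x ≤ M) (x : X) : q x ≤ M * p x := by
  have hlt : ∀ r ∈ Set.Ioi (p x), q x ≤ M * r := by
    intro r hr
    have hr0 : 0 < r := (apply_nonneg p x).trans_lt hr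
    have hqr := h _ (inv_smul_mem_closedBall p hr0 (le_of_lt hr))
    rwa [map_smul_eq_mul, RCLike.norm_ofReal, abs_of_pos (inv_pos.2 hr0),
      inv_mul_le_iff₀ hr0, mul_comm] at hqr
  have hlim : Tendsto (fun r => M * r) (𝓝[>] p x) (𝓝 (M * p x)) :=
    tendsto_nhdsWithin_of_tendsto_nhds (continuous_const_mul M).continuousAt
  exact ge_of_tendsto hlim (eventually_mem_nhdsWithin.mono hlt)

end AbsConvex

section LocallyConvex

variable {𝕜 : Type v} [RCLike 𝕜] {X : Type w} [AddCommGroup X] [Module 𝕜 X]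

theorem mem_nhds_iff_exists_ball [TopologicalSpace X] {S : Set (Seminorm 𝕜 X)}
    (hS : WithSeminorms fun q : S => (q : Seminorm 𝕜 X))
    (hsup : ∀ s : Finset S, (s.sup fun q => (q : Seminorm 𝕜 X)) ∈ S)
    (hsmul : ∀ q ∈ S, ∀ c : NNReal, c • q ∈ S) {x : X} {U : Set X} :
    U ∈ 𝓝 x ↔ ∃ q ∈ S, q.ball x 1 ⊆ U := by
  rw [hS.mem_nhds_iff]
  constructor
  · rintro ⟨s, r, hr, hU⟩
    lift r to NNReal using hr.le
    refine ⟨r⁻¹ • s.sup _, hsmul _ (hsup s) _, ?_⟩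
    simpa [Seminorm.ball_smul _ (inv_pos.2 (NNReal.coe_pos.1 hr))] using hU
  · rintro ⟨q, hq, hU⟩
    exact ⟨{⟨q, hq⟩}, 1, one_pos, by simpa using hU⟩

theorem exists_continuous_seminorm_ball_subset [TopologicalSpace X] [PolynormableSpace 𝕜 X]
    {U : Set X} (hU : U ∈ 𝓝 0) : ∃ q : Seminorm 𝕜 X, Continuous q ∧ q.ball 0 1 ⊆ U :=
  have hw := PolynormableSpace.withSeminorms 𝕜 X
  (mem_nhds_iff_exists_ball (S := {q | Continuous q}) hw
    hw.finset_sups.continuous_seminorm fun _ hq c => hq.const_smul c).1 hU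

variable {τ : TopologicalSpace X}

theorem IsLCH.isTopologicalAddGroup (hτ : IsLCH 𝕜 τ) : @IsTopologicalAddGroup X τ _ :=
  have := hτ.polynormable
  (PolynormableSpace.withSeminorms 𝕜 X).topologicalAddGroup

theorem IsLCH.continuousSMul (hτ : IsLCH 𝕜 τ) : @ContinuousSMul 𝕜 X _ _ τ :=
  have := hτ.polynormable
  (PolynormableSpace.withSeminorms 𝕜 X).continuousSMul

theorem IsLCH.isBdd_singleton (hτ : IsLCH 𝕜 τ) (x : X) : IsBdd 𝕜 τ {x} :=
  have := hτ.continuousSMul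
  isVonNBounded_singleton x

theorem IsLCH.isBdd_sub (hτ : IsLCH 𝕜 τ) {C D : Set X} (hC : IsBdd 𝕜 τ C) (hD : IsBdd 𝕜 τ D) :
    IsBdd 𝕜 τ (C - D) :=
  have := hτ.isTopologicalAddGroup
  IsVonNBounded.sub hC hD

theorem IsLCH.isBdd_insert (hτ : IsLCH 𝕜 τ) (x : X) {C : Set X} (hC : IsBdd 𝕜 τ C) :
    IsBdd 𝕜 τ (insert x C) :=
  have := hτ.continuousSMul
  hC.insert x

theorem norm_le_of_re_le_of_balanced {C : Set X} (hC : Balanced 𝕜 C) {ℓ : X →ₗ[𝕜] 𝕜} {s : ℝ}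
    (h : ∀ x ∈ C, RCLike.re (ℓ x) ≤ s) {x : X} (hx : x ∈ C) : ‖ℓ x‖ ≤ s := by
  obtain ⟨c, hc, hcx⟩ := RCLike.exists_norm_eq_mul_self (ℓ x)
  have hre := h _ (hC.smul_mem hc.le hx)
  rwa [map_smul, smul_eq_mul, ← hcx, RCLike.ofReal_re] at hre

theorem IsLCH.exists_norm_le_one_lt_norm (hτ : IsLCH 𝕜 τ) {C : Set X} (hC : AbsConvex 𝕜 C)
    (hne : C.Nonempty) (hcl : IsClosed[τ] C) {x : X} (hx : x ∉ C) :
    ∃ ℓ : X →L[𝕜] 𝕜, (∀ y ∈ C, ‖ℓ y‖ ≤ 1) ∧ 1 < ‖ℓ x‖ := by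
  have := hτ.polynormable
  have := hτ.isTopologicalAddGroup
  have := hτ.continuousSMul
  let : Module ℝ X := .restrictScalars ℝ 𝕜 X
  have : IsScalarTower ℝ 𝕜 X := .restrictScalars _ _ _
  have : LocallyConvexSpace ℝ X := (PolynormableSpace.withSeminorms 𝕜 X).toLocallyConvexSpace
  obtain ⟨ℓ, s, hℓC, hsx⟩ := RCLike.geometric_hahn_banach_closed_point (𝕜 := 𝕜)
    (convex_RCLike_iff_convex_real.1 hC.2) hcl hx
  have hnorm : ∀ y ∈ C, ‖ℓ y‖ ≤ s := fun y =>
    norm_le_of_re_le_of_balanced (ℓ := (ℓ : X →ₗ[𝕜] 𝕜)) hC.1 fun z hz => (hℓC z hz).le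
  obtain ⟨r, hsr, hrx⟩ := exists_between (hsx.trans_le (RCLike.re_le_norm (ℓ x)))
  have hr : 0 < r := hne.elim fun y hy => ((norm_nonneg _).trans (hnorm y hy)).trans_lt hsr
  have hnorm_smul : ∀ y, ‖(((r⁻¹ : ℝ) : 𝕜) • ℓ) y‖ = r⁻¹ * ‖ℓ y‖ := fun y => by
    rw [smul_apply, norm_smul, RCLike.norm_ofReal, abs_of_pos (inv_pos.2 hr)]
  refine ⟨((r⁻¹ : ℝ) : 𝕜) • ℓ, fun y hy => ?_, ?_⟩
  · rw [hnorm_smul, inv_mul_le_iff₀ hr, mul_one]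
    exact (hnorm y hy).trans hsr.le
  · rwa [hnorm_smul, lt_inv_mul_iff₀ hr, mul_one]

end LocallyConvex

section NormInducing

variable {𝕜 : Type v} [RCLike 𝕜] {X : Type w} [AddCommGroup X] [Module 𝕜 X]
  {τ τ' : TopologicalSpace X} {p : Seminorm 𝕜 X}

theorem isNormInducing_normSeminorm (E : Type*) [NormedAddCommGroup E] [NormedSpace 𝕜 E] :
    IsNormInducing (inferInstance : TopologicalSpace E) (normSeminorm 𝕜 E) :=
  ⟨fun _ h => norm_eq_zero.1 h, (norm_withSeminorms 𝕜 E).congr_equiv (Equiv.ofUnique Unit (Fin 1))⟩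

theorem IsNormInducing.isBdd_iff (hp : IsNormInducing τ p) {B : Set X} :
    IsBdd 𝕜 τ B ↔ ∃ r > 0, ∀ x ∈ B, p x ≤ r := by
  let := τ
  refine (hp.induces.isVonNBounded_iff_seminorm_bounded (s := B)).trans ⟨fun h => ?_, ?_⟩
  · obtain ⟨r, hr, h⟩ := h ()
    exact ⟨r, hr, fun x hx => (h x hx).le⟩
  · rintro ⟨r, hr, h⟩ -
    exact ⟨r + 1, by linarith, fun x hx => by linarith [h x hx]⟩

theorem IsNormInducing.isBdd_closedBall (hp : IsNormInducing τ p) (r : ℝ) :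
    IsBdd 𝕜 τ (p.closedBall 0 r) :=
  hp.isBdd_iff.2 ⟨max r 1, lt_max_of_lt_right one_pos, fun _ hx =>
    (p.mem_closedBall_zero.1 hx).trans (le_max_left _ _)⟩

theorem IsNormInducing.mem_nhds_zero_iff (hp : IsNormInducing τ p) {U : Set X} :
    U ∈ @nhds X τ 0 ↔ ∃ r > 0, p.ball 0 r ⊆ U := by
  have := hp.induces.topologicalAddGroup
  rw [(SeminormFamily.withSeminorms_iff_nhds_eq_iInf _).1 hp.induces, iInf_const,
    (Metric.nhds_basis_ball.comap p).mem_iff]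
  simp only [← p.ball_zero_eq_preimage_ball]

theorem IsNormInducing.of_mem_nhds [σ : TopologicalSpace X] [IsTopologicalAddGroup X]
    (h0 : ∀ x, p x = 0 → x = 0) (h : ∀ U : Set X, U ∈ 𝓝 0 ↔ ∃ r > 0, p.ball 0 r ⊆ U) :
    IsNormInducing σ p := by
  refine ⟨h0, (SeminormFamily.withSeminorms_iff_nhds_eq_iInf _).2 ?_⟩
  ext U
  rw [h, iInf_const, (Metric.nhds_basis_ball.comap p).mem_iff]
  simp only [← p.ball_zero_eq_preimage_ball]

theorem IsNormInducing.isLCH (hp : IsNormInducing τ p) : IsLCH 𝕜 τ := by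
  let := τ
  have := hp.induces.topologicalAddGroup
  have := hp.induces.T1_of_separating fun x hx => ⟨(), fun h => hx (hp.eq_zero x h)⟩
  exact ⟨hp.induces.toPolynormableSpace, inferInstance⟩

theorem IsNormInducing.congr (hp : IsNormInducing τ p) {q : Seminorm 𝕜 X} {a b : ℝ}
    (hpq : ∀ x, p x ≤ a * q x) (hqp : ∀ x, q x ≤ b * p x) : IsNormInducing τ q := by
  let := τ
  refine ⟨fun x hx => hp.eq_zero x (le_antisymm ?_ (apply_nonneg p x)), hp.induces.congr ?_ ?_⟩
  · simpa only [hx, mul_zero] using hpq x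
  · exact .of_real fun _ => ⟨{()}, b, by simpa using hqp⟩
  · exact .of_real fun _ => ⟨{()}, a, by simpa using hpq⟩

theorem IsNormInducing.continuous_of_le_mul (hp : IsNormInducing τ p) {Z : Type*} [AddCommGroup Z]
    [Module 𝕜 Z] {σ : TopologicalSpace Z} {q : Seminorm 𝕜 Z} (hq : IsNormInducing σ q)
    (T : X →ₗ[𝕜] Z) {M : ℝ} (h : ∀ x, q (T x) ≤ M * p x) : Continuous[τ, σ] T :=
  WithSeminorms.continuous_of_isBounded hp.induces hq.induces T
    (.of_real fun _ => ⟨{()}, M, by simpa using h⟩)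

theorem IsNormInducing.comp_of_isTopIso {Y : Type*} [AddCommGroup Y] [Module 𝕜 Y]
    {σ : TopologicalSpace Y} {q : Seminorm 𝕜 Y} (hq : IsNormInducing σ q) {T : X ≃ₗ[𝕜] Y}
    (hT : IsTopIso τ T) : IsNormInducing τ (q.comp (T : X →ₗ[𝕜] Y)) where
  eq_zero _ hx := T.map_eq_zero_iff.1 (hq.eq_zero _ hx)
  induces :=
    have hind : IsInducing (T : X →ₗ[𝕜] Y) := (Homeomorph.mk T.toEquiv hT.1 hT.2).isInducing
    hind.withSeminorms hq.induces

theorem IsLCH.isCompact_closedBall (hτ' : IsLCH 𝕜 τ') (hK : @IsCompact X τ' (p.closedBall 0 1))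
    {r : ℝ} (hr : 0 < r) : @IsCompact X τ' (p.closedBall 0 r) := by
  have := hτ'.continuousSMul
  have hnorm : ‖(r : 𝕜)‖ = r := by rw [RCLike.norm_ofReal, abs_of_pos hr]
  have hsmul := Seminorm.smul_closedBall_zero (p := p) (r := 1) (hr.trans_eq hnorm.symm)
  rw [hnorm, mul_one] at hsmul
  exact hsmul ▸ hK.smul (r : 𝕜)

theorem IsLCH.isClosed_closedBall (hτ' : IsLCH 𝕜 τ') (hK : @IsCompact X τ' (p.closedBall 0 1))
    {r : ℝ} (hr : 0 < r) : IsClosed[τ'] (p.closedBall 0 r) :=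
  have := hτ'.t2
  (hτ'.isCompact_closedBall hK hr).isClosed

theorem completelyNormable_of_isCompact (hp : IsNormInducing τ p) (hτ' : IsLCH 𝕜 τ')
    (hK : @IsCompact X τ' (p.closedBall 0 1)) : CompletelyNormable 𝕜 τ := by
  refine ⟨p, hp, fun s hs => ?_⟩
  have := hτ'.isTopologicalAddGroup
  obtain ⟨N, hN⟩ := hs 1 one_pos
  have hpos : 0 < p (s N) + 1 := add_pos_of_nonneg_of_pos (apply_nonneg _ _) one_pos
  have hbdd : ∀ n ≥ N, s n ∈ p.closedBall 0 (p (s N) + 1) := fun n hn => by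
    rw [Seminorm.mem_closedBall_zero, ← sub_le_iff_le_add']
    exact ((le_abs_self _).trans (abs_sub_map_le_sub p _ _)).trans (hN n hn N le_rfl).le
  obtain ⟨x, -, hx⟩ := (hτ'.isCompact_closedBall hK hpos).exists_mapClusterPt
    (le_principal_iff.2 ((eventually_ge_atTop N).mono hbdd))
  refine ⟨x, Metric.tendsto_atTop.2 fun ε hε => ?_⟩
  obtain ⟨N, hN⟩ := hs (ε / 2) (half_pos hε)
  refine ⟨N, fun n hn => ?_⟩
  have hcl : IsClosed ((fun y => s n - y) ⁻¹' p.closedBall 0 (ε / 2)) :=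
    (hτ'.isClosed_closedBall hK (half_pos hε)).preimage (continuous_const.sub continuous_id)
  have hmem := hcl.mem_of_mapClusterPt hx ((eventually_ge_atTop N).mono fun m hm =>
    p.mem_closedBall_zero.2 (hN n hn m hm).le)
  rw [Set.mem_preimage, Seminorm.mem_closedBall_zero] at hmem
  rw [Real.dist_0_eq_abs, abs_of_nonneg (apply_nonneg _ _)]
  exact hmem.trans_lt (half_lt_self hε)

theorem bbc_of_isCompact (hp : IsNormInducing τ p) (hτ' : IsLCH 𝕜 τ')
    (hK : @IsCompact X τ' (p.closedBall 0 1)) : BBC 𝕜 τ τ' := by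
  intro B hB
  obtain ⟨r, hr, hBr⟩ := hp.isBdd_iff.1 hB
  exact ⟨p.closedBall 0 r, fun x hx => p.mem_closedBall_zero.2 (hBr x hx),
    absConvex_seminorm_closedBall p r, hp.isBdd_closedBall r, hτ'.isCompact_closedBall hK hr⟩

theorem BBC.bbcl (hτ' : @T2Space X τ') (h : BBC 𝕜 τ τ') : BBCl 𝕜 τ τ' := by
  intro B hB
  obtain ⟨C, hBC, hC, hCb, hcomp⟩ := h B hB
  exact ⟨C, hBC, hC, hCb, hcomp.isClosed⟩

theorem cnc_of_isCompact (hp : IsNormInducing τ p) (hτ' : IsLCH 𝕜 τ')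
    (hK : @IsCompact X τ' (p.closedBall 0 1)) : CNC 𝕜 τ τ' := by
  intro U hU
  obtain ⟨r, hr, hrU⟩ := hp.mem_nhds_zero_iff.1 hU
  refine ⟨p.closedBall 0 (r / 2), hp.mem_nhds_zero_iff.2 ⟨r / 2, half_pos hr, ?_⟩,
    fun x hx => hrU ?_, absConvex_seminorm_closedBall p _,
    hτ'.isClosed_closedBall hK (half_pos hr)⟩
  · exact Seminorm.ball_subset_closedBall p 0 (r / 2)
  · rw [Seminorm.mem_closedBall_zero] at hx
    exact p.mem_ball_zero.2 (hx.trans_lt (half_lt_self hr))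

theorem IsNormInducing.exists_closedBall_eq (hp : IsNormInducing τ p) (hτ' : IsLCH 𝕜 τ')
    {C : Set X} (hC : AbsConvex 𝕜 C) (hb : IsBdd 𝕜 τ C) (hsub : p.closedBall 0 1 ⊆ C)
    (hcl : IsClosed[τ'] C) : ∃ q : Seminorm 𝕜 X, IsNormInducing τ q ∧ q.closedBall 0 1 = C := by
  have := hτ'.continuousSMul
  obtain ⟨q, rfl⟩ := exists_seminorm_closedBall_eq hC
    ((p.absorbent_closedBall_zero one_pos).mono hsub) hcl
  obtain ⟨M, -, hM⟩ := hp.isBdd_iff.1 hb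
  exact ⟨q, hp.congr (seminorm_le_mul_of_closedBall hM) (seminorm_le_mul_of_closedBall fun x hx =>
    q.mem_closedBall_zero.1 (hsub hx)), rfl⟩

end NormInducing

section Mixed

variable {𝕜 : Type v} [RCLike 𝕜] {X : Type w} [AddCommGroup X] [Module 𝕜 X]

variable (𝕜) in
/-- The seminorms whose restriction to every `τ`-bounded set is `τ'`-continuous at zero; they
generate the mixed topology `γ(τ, τ')`. -/
def mixedSeminorms (τ τ' : TopologicalSpace X) : Set (Seminorm 𝕜 X) :=
  {q | ∀ C : Set X, IsBdd 𝕜 τ C → Tendsto q (@nhdsWithin X τ' 0 C) (𝓝 0)}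

section Seminorms

variable {τ τ' : TopologicalSpace X} {q q' : Seminorm 𝕜 X}

theorem mem_mixedSeminorms_iff_eventually : q ∈ mixedSeminorms 𝕜 τ τ' ↔
    ∀ C, IsBdd 𝕜 τ C → ∀ ε > 0, ∀ᶠ x in @nhds X τ' 0, x ∈ C → q x < ε := by
  refine forall₂_congr fun C _ => ?_
  simp only [tendsto_order, ← eventually_nhdsWithin_iff]
  exact and_iff_right fun a ha => .of_forall fun x => ha.trans_le (apply_nonneg q x)

theorem mem_mixedSeminorms_of_le_mul (hq : q ∈ mixedSeminorms 𝕜 τ τ') {c : ℝ}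
    (h : ∀ x, q' x ≤ c * q x) : q' ∈ mixedSeminorms 𝕜 τ τ' := fun C hC =>
  squeeze_zero (apply_nonneg q') h <| by simpa only [mul_zero] using (hq C hC).const_mul c

theorem finset_sup_mem_mixedSeminorms (s : Finset (mixedSeminorms 𝕜 τ τ')) :
    (s.sup fun q => (q : Seminorm 𝕜 X)) ∈ mixedSeminorms 𝕜 τ τ' := by
  refine mem_mixedSeminorms_iff_eventually.2 fun C hC ε hε => ?_
  filter_upwards [(Finset.eventually_all s).2 fun q _ =>
    mem_mixedSeminorms_iff_eventually.1 q.2 C hC ε hε] with x hx hxC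
  exact Seminorm.finset_sup_apply_lt hε fun q hq => hx q hq hxC

theorem mem_mixedSeminorms_of_continuous (hq : @Continuous X ℝ τ' _ q) :
    q ∈ mixedSeminorms 𝕜 τ τ' := fun _ _ =>
  (hq.tendsto' 0 0 (map_zero q)).mono_left nhdsWithin_le_nhds

end Seminorms

section MixedSet

variable {U B : ℕ → Set X}

theorem inter_subset_mixedSet (h0 : ∀ k, (0 : X) ∈ U k ∩ B k) (n : ℕ) :
    U n ∩ B n ⊆ mixedSet U B := by
  intro x hx
  have hmem : ∀ k ∈ Finset.range (n + 1), Pi.single (M := fun _ => X) n x k ∈ U k ∩ B k := by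
    intro k _
    rcases eq_or_ne k n with rfl | hk
    · rwa [Pi.single_eq_same]
    · rw [Pi.single_eq_of_ne hk]
      exact h0 k
  have hsum := Set.finsetSum_mem_finsetSum _ _ _ hmem
  rw [Finset.sum_pi_single', if_pos (Finset.self_mem_range_succ n)] at hsum
  exact Set.mem_iUnion_of_mem n hsum

theorem absConvex_mixedSet (hU : ∀ n, AbsConvex 𝕜 (U n)) (hB : ∀ n, AbsConvex 𝕜 (B n))
    (h0 : ∀ k, (0 : X) ∈ U k ∩ B k) : AbsConvex 𝕜 (mixedSet U B) := by
  have hsum : ∀ n, AbsConvex 𝕜 (∑ k ∈ Finset.range n, (U k ∩ B k)) := by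
    intro n
    induction n with
    | zero => exact ⟨balanced_zero, convex_zero⟩
    | succ n ih =>
      rw [Finset.sum_range_succ]
      exact ⟨ih.1.add ((hU n).inter (hB n)).1, ih.2.add ((hU n).inter (hB n)).2⟩
  have hmono : Monotone fun n => ∑ k ∈ Finset.range (n + 1), (U k ∩ B k) :=
    monotone_nat_of_le_succ fun n => by
      rw [Finset.sum_range_succ _ (n + 1)]
      exact Set.subset_add_left _ (h0 (n + 1))
  exact ⟨balanced_iUnion fun n => (hsum (n + 1)).1,
    hmono.directed_le.convex_iUnion fun n => (hsum (n + 1)).2⟩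

end MixedSet

variable {τ τ' : TopologicalSpace X} {U B : ℕ → Set X}

theorem IsMixedBasis.zero_mem (hB : IsMixedBasis 𝕜 τ τ' B) (n : ℕ) : (0 : X) ∈ B n :=
  (hB.absConvex n).1.zero_mem (hB.nonempty n)

theorem IsMixedBasis.pow_two_smul_mem (hB : IsMixedBasis 𝕜 τ τ' B) (n j : ℕ) {x : X}
    (hx : x ∈ B n) : (2 ^ j : 𝕜) • x ∈ B (n + j) := by
  induction j with
  | zero => simpa using hx
  | succ j ih =>
    rw [pow_succ', mul_smul]
    exact hB.two_smul _ (Set.smul_mem_smul_set ih)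

theorem IsMixedBasis.zero_mem_inter (hB : IsMixedBasis 𝕜 τ τ' B) (hU : IsNhdSeq 𝕜 τ' U) (k : ℕ) :
    (0 : X) ∈ U k ∩ B k :=
  ⟨mem_of_mem_nhds (hU k).2, hB.zero_mem k⟩

theorem absorbent_mixedSet (hτ : IsLCH 𝕜 τ) (hτ' : IsLCH 𝕜 τ') (hB : IsMixedBasis 𝕜 τ τ' B)
    (hU : IsNhdSeq 𝕜 τ' U) : Absorbent 𝕜 (mixedSet U B) := by
  intro x
  have := hτ'.continuousSMul
  obtain ⟨n, hn⟩ := hB.basis _ (hτ.isBdd_singleton x)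
  have hUx : Absorbs 𝕜 (U n) {x} := absorbent_nhds_zero (hU n).2 x
  have hBx : Absorbs 𝕜 (B n) {x} := (hB.absConvex n).1.absorbs_self.mono_right hn
  exact (hUx.inter hBx).mono_left (inter_subset_mixedSet (hB.zero_mem_inter hU) n)

theorem exists_ball_subset_mixedSet (hτ : IsLCH 𝕜 τ) (hτ' : IsLCH 𝕜 τ')
    (hB : IsMixedBasis 𝕜 τ τ' B) (hU : IsNhdSeq 𝕜 τ' U) :
    ∃ q ∈ mixedSeminorms 𝕜 τ τ', q.ball 0 1 ⊆ mixedSet U B := by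
  have h0 := hB.zero_mem_inter hU
  obtain ⟨q, hball, hclosedBall⟩ := exists_seminorm_ball_subset_subset_closedBall
    (absConvex_mixedSet (fun n => (hU n).1) hB.absConvex h0) (absorbent_mixedSet hτ hτ' hB hU)
  refine ⟨q, mem_mixedSeminorms_iff_eventually.2 fun C hC ε hε => ?_, hball⟩
  have := hτ'.continuousSMul
  obtain ⟨n, hn⟩ := hB.basis C hC
  obtain ⟨j, hj⟩ := exists_pow_lt_of_lt_one hε (one_half_lt_one (α := ℝ))
  have hlim : Tendsto (fun x : X => (2 ^ j : 𝕜) • x) (𝓝 0) (𝓝 0) :=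
    (continuous_const_smul _).tendsto' 0 0 (smul_zero _)
  filter_upwards [hlim (hU (n + j)).2] with x hxU hxC
  have hqx : q ((2 ^ j : 𝕜) • x) ≤ 1 := q.mem_closedBall_zero.1 <| hclosedBall <|
    inter_subset_mixedSet h0 (n + j) ⟨hxU, hB.pow_two_smul_mem n j (hn hxC)⟩
  rw [map_smul_eq_mul, norm_pow, RCLike.norm_two, ← le_div_iff₀' (by positivity),
    ← one_div_pow] at hqx
  exact hqx.trans_lt hj

theorem exists_mixedSet_subset_ball (hτ' : IsLCH 𝕜 τ') (hB : ∀ k, IsBdd 𝕜 τ (B k))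
    {q : Seminorm 𝕜 X} (hq : q ∈ mixedSeminorms 𝕜 τ τ') :
    ∃ U, IsNhdSeq 𝕜 τ' U ∧ mixedSet U B ⊆ q.ball 0 1 := by
  have := hτ'.polynormable
  have hV : ∀ k : ℕ, ∃ V : Set X, (AbsConvex 𝕜 V ∧ V ∈ @nhds X τ' 0) ∧
      ∀ x ∈ V ∩ B k, q x < (1 / 2) ^ (k + 1) := by
    intro k
    obtain ⟨s, hs, hsub⟩ := exists_continuous_seminorm_ball_subset (𝕜 := 𝕜)
      (mem_mixedSeminorms_iff_eventually.1 hq (B k) (hB k) ((1 / 2) ^ (k + 1)) (by positivity))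
    exact ⟨s.ball 0 1, ⟨absConvex_seminorm_ball s 1, s.ball_mem_nhds hs one_pos⟩,
      fun x hx => hsub hx.1 hx.2⟩
  choose U hU hqU using hV
  refine ⟨U, hU, fun x hx => ?_⟩
  obtain ⟨n, hn⟩ := Set.mem_iUnion.1 hx
  obtain ⟨g, hg, rfl⟩ := (Set.mem_finsetSum _ _ _).1 hn
  rw [Seminorm.mem_ball_zero]
  calc q (∑ k ∈ Finset.range (n + 1), g k)
    _ ≤ ∑ k ∈ Finset.range (n + 1), q (g k) :=
      Finset.le_sum_of_subadditive q (map_zero q).le (map_add_le_add q) _ _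
    _ ≤ ∑ k ∈ Finset.range (n + 1), (1 / 2) ^ k * (1 / 2) :=
      Finset.sum_le_sum fun k hk => (hqU k _ (hg hk)).le
    _ = 1 - (1 / 2) ^ (n + 1) := by
      rw [← Finset.sum_mul, geom_sum_eq (by norm_num)]
      ring
    _ < 1 := sub_lt_self 1 (by positivity)

theorem withSeminorms_mixedTopology (hτ : IsLCH 𝕜 τ) (hτ' : IsLCH 𝕜 τ')
    (hB : ∃ B, IsMixedBasis 𝕜 τ τ' B) :
    @WithSeminorms 𝕜 X _ _ _ _ (fun q : mixedSeminorms 𝕜 τ τ' => (q : Seminorm 𝕜 X))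
      (mixedTopology 𝕜 τ τ') := by
  set P : SeminormFamily 𝕜 X (mixedSeminorms 𝕜 τ τ') := fun q => (q : Seminorm 𝕜 X)
  let σ : TopologicalSpace X := P.moduleFilterBasis.topology
  have hw : @WithSeminorms 𝕜 X _ _ _ _ P σ := @WithSeminorms.mk _ _ _ _ _ _ P σ rfl
  suffices h : mixedTopology 𝕜 τ τ' = σ by rwa [h]
  refine TopologicalSpace.ext_iff.2 fun s => ?_
  have hσ : IsOpen[σ] s ↔ ∀ x ∈ s, ∃ q ∈ mixedSeminorms 𝕜 τ τ', x +ᵥ q.ball 0 1 ⊆ s := by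
    rw [isOpen_iff_mem_nhds]
    simp only [mem_nhds_iff_exists_ball hw finset_sup_mem_mixedSeminorms fun _ hq _ =>
      mem_mixedSeminorms_of_le_mul hq fun _ => le_rfl, Seminorm.vadd_ball, vadd_eq_add, add_zero]
  rw [hσ]
  constructor
  · intro hs x hx
    obtain ⟨B, hB⟩ := hB
    obtain ⟨U, hU, hUs⟩ := hs B hB x hx
    obtain ⟨q, hq, hqU⟩ := exists_ball_subset_mixedSet hτ hτ' hB hU
    exact ⟨q, hq, (Set.vadd_set_mono hqU).trans hUs⟩
  · intro hs B hB x hx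
    obtain ⟨q, hq, hqs⟩ := hs x hx
    obtain ⟨U, hU, hUq⟩ := exists_mixedSet_subset_ball hτ' hB.bdd hq
    exact ⟨U, hU, (Set.vadd_set_mono hUq).trans hqs⟩

theorem mixedTopology_le (hτ : IsLCH 𝕜 τ) (hτ' : IsLCH 𝕜 τ')
    (hB : ∃ B, IsMixedBasis 𝕜 τ τ' B) : mixedTopology 𝕜 τ τ' ≤ τ' := by
  have := hτ'.polynormable
  have hbdd : Seminorm.IsBounded (fun q : mixedSeminorms 𝕜 τ τ' => (q : Seminorm 𝕜 X))
      (fun q : {q : Seminorm 𝕜 X // Continuous q} => (q : Seminorm 𝕜 X)) LinearMap.id :=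
    .of_real fun q => ⟨{⟨q, mem_mixedSeminorms_of_continuous q.2⟩}, 1, by simp⟩
  exact continuous_id_iff_le.1 (WithSeminorms.continuous_of_isBounded
    (withSeminorms_mixedTopology hτ hτ' hB) (PolynormableSpace.withSeminorms 𝕜 X) _ hbdd)

theorem isLCH_mixedTopology (hτ : IsLCH 𝕜 τ) (hτ' : IsLCH 𝕜 τ')
    (hB : ∃ B, IsMixedBasis 𝕜 τ τ' B) : IsLCH 𝕜 (mixedTopology 𝕜 τ τ') where
  polynormable := @WithSeminorms.toPolynormableSpace _ _ _ _ _ _ (mixedTopology 𝕜 τ τ') _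
    (withSeminorms_mixedTopology hτ hτ' hB)
  t2 := @T2Space.of_injective_continuous X X (mixedTopology 𝕜 τ τ') τ' hτ'.t2 id
    Function.injective_id (continuous_id_iff_le.2 (mixedTopology_le hτ hτ' hB))

theorem continuous_mixedTopology_of_mem_mixedSeminorms (hτ : IsLCH 𝕜 τ) (hτ' : IsLCH 𝕜 τ')
    (hB : ∃ B, IsMixedBasis 𝕜 τ τ' B) {E : Type*} [NormedAddCommGroup E] [NormedSpace 𝕜 E]
    {T : X →ₗ[𝕜] E} (hT : (normSeminorm 𝕜 E).comp T ∈ mixedSeminorms 𝕜 τ τ') :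
    @Continuous X E (mixedTopology 𝕜 τ τ') _ T :=
  WithSeminorms.continuous_of_isBounded (withSeminorms_mixedTopology hτ hτ' hB)
    (norm_withSeminorms 𝕜 E) T (.of_real fun _ => ⟨{⟨_, hT⟩}, 1, by simp⟩)

end Mixed

section MixedNormed

variable {𝕜 : Type v} [RCLike 𝕜] {X : Type w} [AddCommGroup X] [Module 𝕜 X]
  {τ τ' : TopologicalSpace X} {p : Seminorm 𝕜 X}

theorem exists_isMixedBasis (hp : IsNormInducing τ p) (hτ' : IsLCH 𝕜 τ')
    (hcl : IsClosed[τ'] (p.closedBall 0 1)) : ∃ B, IsMixedBasis 𝕜 τ τ' B := by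
  have := hτ'.continuousSMul
  have hball : ∀ n : ℕ, (2 ^ n : 𝕜) • p.closedBall 0 1 = p.closedBall 0 (2 ^ n) := fun n => by
    rw [Seminorm.smul_closedBall_zero (norm_pos_iff.2 (by positivity)), norm_pow,
      RCLike.norm_two, mul_one]
  refine ⟨fun n => p.closedBall 0 (2 ^ n), ⟨fun n => ⟨0, ?_⟩,
    fun n => absConvex_seminorm_closedBall p _, fun n => hp.isBdd_closedBall _, fun n => ?_,
    fun C hC => ?_, fun n => ?_⟩⟩
  · exact p.mem_closedBall_self (by positivity)
  · exact hball n ▸ hcl.smul_of_ne_zero (by positivity)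
  · obtain ⟨r, -, hCr⟩ := hp.isBdd_iff.1 hC
    obtain ⟨n, hn⟩ := pow_unbounded_of_one_lt r one_lt_two
    exact ⟨n, fun x hx => p.mem_closedBall_zero.2 ((hCr x hx).trans hn.le)⟩
  · rw [← hball, ← hball, smul_smul, ← pow_succ']

theorem le_mixedTopology (hp : IsNormInducing τ p) (hτ' : IsLCH 𝕜 τ') (hle : τ ≤ τ')
    (hB : ∃ B, IsMixedBasis 𝕜 τ τ' B) : τ ≤ mixedTopology 𝕜 τ τ' := by
  have := hp.isLCH.isTopologicalAddGroup
  have := hp.isLCH.continuousSMul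
  have hcont : ∀ q ∈ mixedSeminorms 𝕜 τ τ', @Continuous X ℝ τ _ q := fun q hq => by
    refine @Seminorm.continuous 𝕜 X _ _ _ τ _ _ q 1 ?_
    filter_upwards [nhds_mono hle (mem_mixedSeminorms_iff_eventually.1 hq _
      (hp.isBdd_closedBall 1) 1 one_pos), hp.mem_nhds_zero_iff.2
      ⟨1, one_pos, p.ball_subset_closedBall 0 1⟩] with x hx hxp
    exact q.mem_ball_zero.2 (hx hxp)
  exact continuous_id_iff_le.1 (@WithSeminorms.continuous_of_continuous_comp _ _ _ _ _ _ _ _ _ _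
    _ _ _ _ τ _ (mixedTopology 𝕜 τ τ') (withSeminorms_mixedTopology hp.isLCH hτ' hB)
    LinearMap.id fun q => hcont q q.2)

theorem isBdd_mixedTopology_iff (hτ : IsLCH 𝕜 τ) (hτ' : IsLCH 𝕜 τ')
    (hB : ∃ B, IsMixedBasis 𝕜 τ τ' B) {C : Set X} : IsBdd 𝕜 (mixedTopology 𝕜 τ τ') C ↔
      ∀ q ∈ mixedSeminorms 𝕜 τ τ', ∃ r > 0, ∀ x ∈ C, q x < r :=
  (@WithSeminorms.isVonNBounded_iff_seminorm_bounded _ _ _ _ _ _ _ (_) _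
    (withSeminorms_mixedTopology hτ hτ' hB)).trans Subtype.forall

theorem bddAbove_range_of_le_mul {q : ℕ → Seminorm 𝕜 X} {a : ℕ → ℝ} (ha : BddAbove (Set.range a))
    (h : ∀ n x, q n x ≤ a n * p x) : BddAbove (Set.range q) := by
  obtain ⟨b, hb⟩ := ha
  refine Seminorm.bddAbove_range_iff.2 fun x => ⟨b * p x, ?_⟩
  rintro _ ⟨n, rfl⟩
  exact (h n x).trans (mul_le_mul_of_nonneg_right (hb ⟨n, rfl⟩) (apply_nonneg p x))

theorem iSup_mem_mixedSeminorms (hp : IsNormInducing τ p) {q : ℕ → Seminorm 𝕜 X} {a : ℕ → ℝ}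
    (hq : ∀ n, q n ∈ mixedSeminorms 𝕜 τ τ') (ha : Tendsto a atTop (𝓝 0))
    (h : ∀ n x, q n x ≤ a n * p x) : (⨆ n, q n) ∈ mixedSeminorms 𝕜 τ τ' := by
  refine mem_mixedSeminorms_iff_eventually.2 fun C hC ε hε => ?_
  obtain ⟨r, hr, hCr⟩ := hp.isBdd_iff.1 hC
  obtain ⟨N, hN⟩ := eventually_atTop.1 (ha.eventually_lt_const (div_pos (half_pos hε) hr))
  filter_upwards [(Finset.eventually_all (Finset.range N)).2 fun n _ =>
    mem_mixedSeminorms_iff_eventually.1 (hq n) C hC _ (half_pos hε)] with x hx hxC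
  rw [Seminorm.iSup_apply (bddAbove_range_of_le_mul ha.bddAbove_range h)]
  refine (ciSup_le fun n => ?_).trans_lt (half_lt_self hε)
  rcases lt_or_ge n N with hn | hn
  · exact (hx n (Finset.mem_range.2 hn) hxC).le
  · calc q n x ≤ a n * p x := h n x
      _ ≤ ε / 2 / r * r :=
        mul_le_mul (hN n hn).le (hCr x hxC) (apply_nonneg p x) (by positivity)
      _ = ε / 2 := div_mul_cancel₀ _ hr.ne'

theorem exists_norm_le_lt_norm_of_isClosed_closedBall (hτ' : IsLCH 𝕜 τ')
    (hcl : IsClosed[τ'] (p.closedBall 0 1)) {r : ℝ} (hr : 0 < r) {x : X} (hx : r < p x) :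
    ∃ ℓ : X →ₗ[𝕜] 𝕜, @Continuous X 𝕜 τ' _ ℓ ∧ (∀ y, ‖ℓ y‖ ≤ p y) ∧ r < ‖ℓ x‖ := by
  have hnorm : ‖((r⁻¹ : ℝ) : 𝕜)‖ = r⁻¹ := by rw [RCLike.norm_ofReal, abs_of_pos (inv_pos.2 hr)]
  have hmem : ((r⁻¹ : ℝ) : 𝕜) • x ∉ p.closedBall 0 1 := by
    rwa [Seminorm.mem_closedBall_zero, map_smul_eq_mul, hnorm, not_le, lt_inv_mul_iff₀ hr, mul_one]
  obtain ⟨ℓ, hℓ, hℓx⟩ := hτ'.exists_norm_le_one_lt_norm (absConvex_seminorm_closedBall p 1)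
    ⟨0, p.mem_closedBall_self zero_le_one⟩ hcl hmem
  refine ⟨ℓ, ℓ.continuous, fun y => ?_, ?_⟩
  · simpa using seminorm_le_mul_of_closedBall
      (q := (normSeminorm 𝕜 𝕜).comp (ℓ : X →ₗ[𝕜] 𝕜)) hℓ y
  · rwa [map_smul, norm_smul, hnorm, lt_inv_mul_iff₀ hr, mul_one] at hℓx

theorem isBdd_of_isBdd_mixedTopology (hp : IsNormInducing τ p) (hτ' : IsLCH 𝕜 τ')
    (hcl : IsClosed[τ'] (p.closedBall 0 1)) {C : Set X}
    (hC : IsBdd 𝕜 (mixedTopology 𝕜 τ τ') C) : IsBdd 𝕜 τ C := by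
  -- If `p (x n) > 4 ^ n` on `C`, norming functionals `ℓ n` of the `x n` give the mixed seminorm
  -- `⨆ n, 2⁻ⁿ ‖ℓ n ·‖`, which exceeds `2 ^ n` at `x n`.
  by_contra hCτ
  have hlarge : ∀ n : ℕ, ∃ x ∈ C, 4 ^ n < p x := by
    intro n
    by_contra! hn
    exact hCτ (hp.isBdd_iff.2 ⟨4 ^ n, by positivity, hn⟩)
  choose x hxC hx using hlarge
  choose ℓ hℓ hℓp hℓx using fun n =>
    exists_norm_le_lt_norm_of_isClosed_closedBall hτ' hcl (by positivity) (hx n)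
  let q : ℕ → Seminorm 𝕜 X := fun n => (1 / 2 : NNReal) ^ n • (normSeminorm 𝕜 𝕜).comp (ℓ n)
  have hq_apply : ∀ n y, q n y = (1 / 2) ^ n * ‖ℓ n y‖ := fun n y => by
    simp [q, NNReal.smul_def]
  have hqp : ∀ n y, q n y ≤ (1 / 2) ^ n * p y := fun n y =>
    (hq_apply n y).trans_le (mul_le_mul_of_nonneg_left (hℓp n y) (by positivity))
  have hq : ∀ n, q n ∈ mixedSeminorms 𝕜 τ τ' := fun n => mem_mixedSeminorms_of_continuous <|
    (continuous_const.mul (hℓ n).norm).congr fun y => (hq_apply n y).symm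
  have hlim : Tendsto (fun n : ℕ => (1 / 2 : ℝ) ^ n) atTop (𝓝 0) :=
    tendsto_pow_atTop_nhds_zero_of_lt_one (by norm_num) (by norm_num)
  obtain ⟨r, -, hr⟩ := (isBdd_mixedTopology_iff hp.isLCH hτ' (exists_isMixedBasis hp hτ' hcl)).1 hC
    _ (iSup_mem_mixedSeminorms hp hq hlim hqp)
  obtain ⟨n, hn⟩ := pow_unbounded_of_one_lt r one_lt_two
  have hbdd := bddAbove_range_of_le_mul hlim.bddAbove_range hqp
  refine lt_irrefl r ?_
  calc r < 2 ^ n := hn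
    _ = (1 / 2) ^ n * 4 ^ n := by rw [← mul_pow]; norm_num
    _ ≤ (1 / 2) ^ n * ‖ℓ n (x n)‖ := by gcongr; exact (hℓx n).le
    _ = q n (x n) := (hq_apply n _).symm
    _ ≤ (⨆ n, q n) (x n) := by
      rw [Seminorm.iSup_apply hbdd]
      exact le_ciSup (Seminorm.bddAbove_range_iff.1 hbdd (x n)) n
    _ < r := hr _ (hxC n)

theorem sameBounded_mixedTopology (hp : IsNormInducing τ p) (hτ' : IsLCH 𝕜 τ') (hle : τ ≤ τ')
    (hcl : IsClosed[τ'] (p.closedBall 0 1)) : SameBounded 𝕜 τ (mixedTopology 𝕜 τ τ') := fun _ =>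
  ⟨fun hC => hC.of_topologicalSpace_le
      (le_mixedTopology hp hτ' hle (exists_isMixedBasis hp hτ' hcl)),
    isBdd_of_isBdd_mixedTopology hp hτ' hcl⟩

theorem continuousOn_id_mixedTopology (hτ : IsLCH 𝕜 τ) (hτ' : IsLCH 𝕜 τ')
    (hB : ∃ B, IsMixedBasis 𝕜 τ τ' B) {C : Set X} (hC : IsBdd 𝕜 τ C) :
    @ContinuousOn X X τ' (mixedTopology 𝕜 τ τ') id C := by
  intro x hx
  refine (@WithSeminorms.tendsto_nhds _ _ _ _ _ _ _ (mixedTopology 𝕜 τ τ') _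
    (withSeminorms_mixedTopology hτ hτ' hB) _ _ _).2 fun q ε hε => ?_
  have := hτ'.isTopologicalAddGroup
  have hlim : Tendsto (fun y => y - x) (𝓝[C] x) (𝓝 0) := by
    simpa only [sub_self] using ((continuous_sub_right x).tendsto x).mono_left nhdsWithin_le_nhds
  have hq := mem_mixedSeminorms_iff_eventually.1 q.2 _ (hτ.isBdd_sub hC hC) ε hε
  filter_upwards [hlim.eventually hq, self_mem_nhdsWithin] with y hy hyC
  exact hy (Set.sub_mem_sub hyC hx)

theorem isCompact_mixedTopology (hτ : IsLCH 𝕜 τ) (hτ' : IsLCH 𝕜 τ')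
    (hB : ∃ B, IsMixedBasis 𝕜 τ τ' B) {C : Set X} (hC : IsBdd 𝕜 τ C) (hcomp : @IsCompact X τ' C) :
    @IsCompact X (mixedTopology 𝕜 τ τ') C :=
  Set.image_id C ▸ @IsCompact.image_of_continuousOn X X τ' (mixedTopology 𝕜 τ τ') C id hcomp
    (continuousOn_id_mixedTopology hτ hτ' hB hC)

theorem continuous_mixedTopology_of_memBddDual (hτ : IsLCH 𝕜 τ) (hτ' : IsLCH 𝕜 τ')
    (hB : ∃ B, IsMixedBasis 𝕜 τ τ' B) {ℓ : X →ₗ[𝕜] 𝕜} (hℓ : MemBddDual 𝕜 τ τ' ℓ) :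
    @Continuous X 𝕜 (mixedTopology 𝕜 τ τ') _ ℓ := by
  refine continuous_mixedTopology_of_mem_mixedSeminorms hτ hτ' hB fun C hC => ?_
  have hlim := hℓ _ (hτ.isBdd_insert 0 hC) 0 (Set.mem_insert 0 C)
  rw [ContinuousWithinAt, map_zero] at hlim
  exact tendsto_zero_iff_norm_tendsto_zero.1
    (hlim.mono_left (nhdsWithin_mono _ (Set.subset_insert 0 C)))

theorem memBddDual_of_memBddDual_mixedTopology (hτ : IsLCH 𝕜 τ) (hτ' : IsLCH 𝕜 τ')
    (hB : ∃ B, IsMixedBasis 𝕜 τ τ' B) {ℓ : X →ₗ[𝕜] 𝕜}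
    (hℓ : MemBddDual 𝕜 τ (mixedTopology 𝕜 τ τ') ℓ) : MemBddDual 𝕜 τ τ' ℓ := fun C hC =>
  @ContinuousOn.comp X X 𝕜 τ' (mixedTopology 𝕜 τ τ') _ id _ ℓ _ (hℓ C hC)
    (continuousOn_id_mixedTopology hτ hτ' hB hC) (Set.mapsTo_id C)

end MixedNormed

section Dual

variable {𝕜 : Type v} [RCLike 𝕜] {X : Type w} [AddCommGroup X] [Module 𝕜 X]

section DualSeminorm

variable [TopologicalSpace X] {C : Set X} {p : Seminorm 𝕜 X}

/-- The seminorm of uniform convergence on `C`, which is the dual norm if `C` is a unit ball. It is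
zero unless all continuous linear functionals are bounded on `C`. -/
noncomputable def dualSeminorm (C : Set X) : Seminorm 𝕜 (StrongDual 𝕜 X) :=
  ⨆ x : C, (normSeminorm 𝕜 𝕜).comp ((topDualPairing 𝕜 X).flip x)

theorem bddAbove_range_norm_apply (hC : IsVonNBounded 𝕜 C) (ℓ : StrongDual 𝕜 X) :
    BddAbove (Set.range fun x : C => ‖ℓ x‖) := by
  obtain ⟨M, hM⟩ := (NormedSpace.isVonNBounded_iff' 𝕜).1 (hC.image ℓ)
  exact ⟨M, Set.forall_mem_range.2 fun x => hM _ (Set.mem_image_of_mem ℓ x.2)⟩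

theorem dualSeminorm_apply (hC : IsVonNBounded 𝕜 C) (ℓ : StrongDual 𝕜 X) :
    dualSeminorm C ℓ = ⨆ x : C, ‖ℓ x‖ :=
  Seminorm.iSup_apply (Seminorm.bddAbove_range_iff.2 (bddAbove_range_norm_apply hC))

theorem norm_le_dualSeminorm (hC : IsVonNBounded 𝕜 C) (ℓ : StrongDual 𝕜 X) {x : X} (hx : x ∈ C) :
    ‖ℓ x‖ ≤ dualSeminorm C ℓ := by
  rw [dualSeminorm_apply hC]
  exact le_ciSup (bddAbove_range_norm_apply hC ℓ) ⟨x, hx⟩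

theorem dualSeminorm_le (hC : IsVonNBounded 𝕜 C) {ℓ : StrongDual 𝕜 X} {M : ℝ} (hM : 0 ≤ M)
    (h : ∀ x ∈ C, ‖ℓ x‖ ≤ M) : dualSeminorm C ℓ ≤ M := by
  rw [dualSeminorm_apply hC]
  exact Real.iSup_le (fun x => h x x.2) hM

theorem dualSeminorm_ball_mem_nhds (hC : IsVonNBounded 𝕜 C) {r : ℝ} (hr : 0 < r) :
    (dualSeminorm C).ball (0 : StrongDual 𝕜 X) r ∈ 𝓝 0 := by
  refine ContinuousLinearMap.hasBasis_nhds_zero.mem_iff.2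
    ⟨(C, Metric.ball 0 (r / 2)), ⟨hC, Metric.ball_mem_nhds _ (half_pos hr)⟩, fun ℓ hℓ => ?_⟩
  have hle : dualSeminorm C ℓ ≤ r / 2 :=
    dualSeminorm_le hC (half_pos hr).le fun x hx => (mem_ball_zero_iff.1 (hℓ x hx)).le
  exact Seminorm.mem_ball_zero _ |>.2 (hle.trans_lt (half_lt_self hr))

theorem continuous_of_norm_le_dualSeminorm (hC : IsVonNBounded 𝕜 C)
    {L : StrongDual 𝕜 X →ₗ[𝕜] 𝕜} (hL : ∀ ℓ, ‖L ℓ‖ ≤ dualSeminorm C ℓ) : Continuous L := by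
  refine continuous_of_continuousAt_zero L ?_
  rw [ContinuousAt, map_zero]
  refine Metric.nhds_basis_ball.tendsto_right_iff.2 fun ε hε => ?_
  filter_upwards [dualSeminorm_ball_mem_nhds hC hε] with ℓ hℓ
  exact mem_ball_zero_iff.2 ((hL ℓ).trans_lt (Seminorm.mem_ball_zero _ |>.1 hℓ))

theorem norm_le_dualSeminorm_mul (hC : IsVonNBounded 𝕜 (p.closedBall 0 1)) (ℓ : StrongDual 𝕜 X)
    (x : X) : ‖ℓ x‖ ≤ dualSeminorm (p.closedBall 0 1) ℓ * p x :=
  seminorm_le_mul_of_closedBall (q := (normSeminorm 𝕜 𝕜).comp (ℓ : X →ₗ[𝕜] 𝕜))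
    (fun _ => norm_le_dualSeminorm hC ℓ) x

theorem isVonNBounded_closedBall (hb : ∀ C : Set X, IsVonNBounded 𝕜 C ↔ ∃ r > 0, ∀ x ∈ C, p x ≤ r) :
    IsVonNBounded 𝕜 (p.closedBall 0 1) :=
  (hb _).2 ⟨1, one_pos, fun _ => p.mem_closedBall_zero.1⟩

theorem isNormInducing_dualSeminorm
    (hb : ∀ C : Set X, IsVonNBounded 𝕜 C ↔ ∃ r > 0, ∀ x ∈ C, p x ≤ r) :
    IsNormInducing (inferInstance : TopologicalSpace (StrongDual 𝕜 X))
      (dualSeminorm (p.closedBall 0 1)) := by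
  have hball := isVonNBounded_closedBall hb
  refine IsNormInducing.of_mem_nhds (fun ℓ hℓ => ?_) fun U => ⟨fun hU => ?_, ?_⟩
  · ext x
    have hle := norm_le_dualSeminorm_mul hball ℓ x
    rw [hℓ, zero_mul] at hle
    exact norm_le_zero_iff.1 hle
  · obtain ⟨⟨S, V⟩, ⟨hS, hV⟩, hSV⟩ := ContinuousLinearMap.hasBasis_nhds_zero.mem_iff.1 hU
    obtain ⟨r, hr, hSr⟩ := (hb S).1 hS
    obtain ⟨ε, hε, hεV⟩ := Metric.mem_nhds_iff.1 hV
    refine ⟨ε / r, div_pos hε hr, fun ℓ hℓ => hSV fun x hx => hεV (mem_ball_zero_iff.2 ?_)⟩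
    rw [Seminorm.mem_ball_zero, lt_div_iff₀ hr] at hℓ
    calc ‖ℓ x‖ ≤ dualSeminorm (p.closedBall 0 1) ℓ * p x := norm_le_dualSeminorm_mul hball ℓ x
      _ ≤ dualSeminorm (p.closedBall 0 1) ℓ * r :=
        mul_le_mul_of_nonneg_left (hSr x hx) (apply_nonneg _ _)
      _ < ε := hℓ
  · rintro ⟨r, hr, hU⟩
    exact mem_of_superset (dualSeminorm_ball_mem_nhds hball hr) hU

theorem exists_linearMap_norm_sub_le (hball : IsVonNBounded 𝕜 (p.closedBall 0 1))
    {s : ℕ → StrongDual 𝕜 X} (hs : ∀ ε > 0, ∃ N, ∀ m ≥ N, ∀ n ≥ N,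
      dualSeminorm (p.closedBall 0 1) (s m - s n) < ε) :
    ∃ ℓ : X →ₗ[𝕜] 𝕜, ∀ ε > 0, ∃ N, ∀ n ≥ N, ∀ x, ‖s n x - ℓ x‖ ≤ ε * p x := by
  have hsub : ∀ ε > 0, ∃ N, ∀ m ≥ N, ∀ n ≥ N, ∀ x, ‖s m x - s n x‖ ≤ ε * p x := by
    intro ε hε
    obtain ⟨N, hN⟩ := hs ε hε
    exact ⟨N, fun m hm n hn x => (norm_le_dualSeminorm_mul hball (s m - s n) x).trans
      (mul_le_mul_of_nonneg_right (hN m hm n hn).le (apply_nonneg p x))⟩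
  have hcauchy : ∀ x, CauchySeq fun n => s n x := by
    refine fun x => Metric.cauchySeq_iff.2 fun ε hε => ?_
    have hpos : 0 < p x + 1 := add_pos_of_nonneg_of_pos (apply_nonneg p x) one_pos
    obtain ⟨N, hN⟩ := hsub (ε / (p x + 1)) (div_pos hε hpos)
    refine ⟨N, fun m hm n hn => ?_⟩
    calc dist (s m x) (s n x) = ‖s m x - s n x‖ := dist_eq_norm _ _
      _ ≤ ε / (p x + 1) * p x := hN m hm n hn x
      _ < ε / (p x + 1) * (p x + 1) := mul_lt_mul_of_pos_left (lt_add_one _) (div_pos hε hpos)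
      _ = ε := div_mul_cancel₀ _ hpos.ne'
  choose g hg using fun x => cauchySeq_tendsto_of_complete (hcauchy x)
  refine ⟨linearMapOfTendsto g (fun n => (s n : X →ₗ[𝕜] 𝕜)) (tendsto_pi_nhds.2 hg),
    fun ε hε => ?_⟩
  obtain ⟨N, hN⟩ := hsub ε hε
  exact ⟨N, fun n hn x => le_of_tendsto (tendsto_const_nhds.sub (hg x)).norm
    ((eventually_ge_atTop N).mono fun m hm => hN n hn m hm x)⟩

theorem completelyNormable_strongDual
    (hb : ∀ C : Set X, IsVonNBounded 𝕜 C ↔ ∃ r > 0, ∀ x ∈ C, p x ≤ r)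
    (hc : ∀ ℓ : X →ₗ[𝕜] 𝕜, (∀ C, IsVonNBounded 𝕜 C → ContinuousOn ℓ C) → Continuous ℓ) :
    CompletelyNormable 𝕜 (inferInstance : TopologicalSpace (StrongDual 𝕜 X)) := by
  have hball := isVonNBounded_closedBall hb
  refine ⟨dualSeminorm (p.closedBall 0 1), isNormInducing_dualSeminorm hb, fun s hs => ?_⟩
  obtain ⟨ℓ, hℓ⟩ := exists_linearMap_norm_sub_le hball hs
  have hcont : Continuous ℓ := by
    refine hc ℓ fun C hC => TendstoUniformlyOn.continuousOn (F := fun n x => s n x) (p := atTop)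
      (Metric.tendstoUniformlyOn_iff.2 fun ε hε => ?_)
      (Frequently.of_forall fun n => (s n).continuous.continuousOn)
    obtain ⟨r, hr, hCr⟩ := (hb C).1 hC
    obtain ⟨N, hN⟩ := hℓ (ε / 2 / r) (div_pos (half_pos hε) hr)
    filter_upwards [eventually_ge_atTop N] with n hn x hx
    calc dist (ℓ x) (s n x) = ‖s n x - ℓ x‖ := by rw [dist_comm, dist_eq_norm]
      _ ≤ ε / 2 / r * p x := hN n hn x
      _ ≤ ε / 2 / r * r := mul_le_mul_of_nonneg_left (hCr x hx) (by positivity)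
      _ = ε / 2 := div_mul_cancel₀ _ hr.ne'
      _ < ε := half_lt_self hε
  refine ⟨⟨ℓ, hcont⟩, Metric.tendsto_atTop.2 fun ε hε => ?_⟩
  obtain ⟨N, hN⟩ := hℓ (ε / 2) (half_pos hε)
  refine ⟨N, fun n hn => ?_⟩
  rw [Real.dist_0_eq_abs, abs_of_nonneg (apply_nonneg _ _)]
  refine (dualSeminorm_le hball (half_pos hε).le fun x hx => ?_).trans_lt (half_lt_self hε)
  exact (hN n hn x).trans (mul_le_of_le_one_right (half_pos hε).le (p.mem_closedBall_zero.1 hx))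

end DualSeminorm

section Helly

variable [TopologicalSpace X] {C : Set X} {φ : StrongDual 𝕜 X →ₗ[𝕜] 𝕜}

theorem exists_mem_forall_finite_apply_eq (hC : AbsConvex 𝕜 C) (hne : C.Nonempty)
    (hcomp : IsCompact C) (hφ : ∀ ℓ, (∀ x ∈ C, ‖ℓ x‖ ≤ 1) → ‖φ ℓ‖ ≤ 1) {ι : Type*} [Finite ι]
    (ℓ : ι → StrongDual 𝕜 X) : ∃ x ∈ C, ∀ i, φ (ℓ i) = ℓ i x := by
  classical
  have := Fintype.ofFinite ι
  let T : X →L[𝕜] ι → 𝕜 := .pi ℓ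
  suffices h : (fun i => φ (ℓ i)) ∈ T '' C by
    obtain ⟨x, hx, hTx⟩ := h
    exact ⟨x, hx, fun i => (congrFun hTx i).symm⟩
  by_contra hmem
  obtain ⟨g, hgC, hg⟩ := (isNormInducing_normSeminorm (𝕜 := 𝕜) (ι → 𝕜)).isLCH
    |>.exists_norm_le_one_lt_norm (absConvex_image hC (T : X →ₗ[𝕜] ι → 𝕜)) (hne.image T)
      (hcomp.image T.continuous).isClosed hmem
  have hg_apply := LinearMap.pi_apply_eq_sum_univ (g : (ι → 𝕜) →ₗ[𝕜] 𝕜)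
  have hgT : φ (g.comp T) = g fun i => φ (ℓ i) := by
    have hsum : g.comp T = ∑ i, g (fun j => if i = j then 1 else 0) • ℓ i := by
      ext x
      refine (hg_apply (T x)).trans ?_
      simp [T, mul_comm]
    rw [hsum, map_sum]
    refine Eq.trans ?_ (hg_apply _).symm
    simp [mul_comm]
  rw [← hgT] at hg
  exact hg.not_ge (hφ _ fun x hx => hgC _ (Set.mem_image_of_mem T hx))

theorem exists_mem_forall_apply_eq (hC : AbsConvex 𝕜 C) (hne : C.Nonempty) (hcomp : IsCompact C)
    (hφ : ∀ ℓ, (∀ x ∈ C, ‖ℓ x‖ ≤ 1) → ‖φ ℓ‖ ≤ 1) : ∃ x ∈ C, ∀ ℓ, φ ℓ = ℓ x := by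
  obtain ⟨x, hxC, hx⟩ := hcomp.inter_iInter_nonempty (fun ℓ : StrongDual 𝕜 X => {x | φ ℓ = ℓ x})
    (fun ℓ => isClosed_eq continuous_const ℓ.continuous) fun u => by
      obtain ⟨x, hxC, hx⟩ :=
        exists_mem_forall_finite_apply_eq hC hne hcomp hφ fun ℓ : u => (ℓ : StrongDual 𝕜 X)
      exact ⟨x, hxC, Set.mem_iInter₂.2 fun ℓ hℓ => hx ⟨ℓ, hℓ⟩⟩
  exact ⟨x, hxC, Set.mem_iInter.1 hx⟩

end Helly

section Bidual

variable (𝕜 X) in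
/-- The evaluation map of a space into its strong bidual. -/
def evalBidual [TopologicalSpace X] [ContinuousSMul 𝕜 X] :
    X →ₗ[𝕜] StrongDual 𝕜 (StrongDual 𝕜 X) where
  toFun x := ⟨(topDualPairing 𝕜 X).flip x, continuous_eval_const x⟩
  map_add' x y := by ext ℓ; exact map_add ℓ x y
  map_smul' c x := by ext ℓ; exact map_smul ℓ c x

theorem evalBidual_apply [TopologicalSpace X] [ContinuousSMul 𝕜 X] (x : X) (ℓ : StrongDual 𝕜 X) :
    evalBidual 𝕜 X x ℓ = ℓ x :=
  rfl

variable [σ : TopologicalSpace X] [ContinuousSMul 𝕜 X] {p : Seminorm 𝕜 X}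

theorem dualSeminorm_evalBidual (hσ : IsLCH 𝕜 σ)
    (hb : ∀ C : Set X, IsVonNBounded 𝕜 C ↔ ∃ r > 0, ∀ x ∈ C, p x ≤ r)
    (hcl : IsClosed (p.closedBall 0 1)) (x : X) :
    dualSeminorm ((dualSeminorm (p.closedBall 0 1)).closedBall 0 1) (evalBidual 𝕜 X x) = p x := by
  have hball := isVonNBounded_closedBall hb
  have hdual := (isNormInducing_dualSeminorm hb).isBdd_closedBall 1
  refine le_antisymm (dualSeminorm_le hdual (apply_nonneg p x) fun ℓ hℓ => ?_) ?_
  · exact (norm_le_dualSeminorm_mul hball ℓ x).trans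
      (mul_le_of_le_one_left (apply_nonneg p x) (Seminorm.mem_closedBall_zero _ |>.1 hℓ))
  · by_contra! hlt
    obtain ⟨r, hr, hrx⟩ := exists_between hlt
    obtain ⟨ℓ, hℓ, hℓp, hℓx⟩ := exists_norm_le_lt_norm_of_isClosed_closedBall hσ hcl
      ((apply_nonneg _ _).trans_lt hr) hrx
    have hmem : (⟨ℓ, hℓ⟩ : StrongDual 𝕜 X) ∈ (dualSeminorm (p.closedBall 0 1)).closedBall 0 1 :=
      Seminorm.mem_closedBall_zero _ |>.2 <| dualSeminorm_le hball zero_le_one fun y hy =>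
        (hℓp y).trans (p.mem_closedBall_zero.1 hy)
    exact (hr.trans hℓx).not_ge (norm_le_dualSeminorm hdual (evalBidual 𝕜 X x) hmem)

theorem surjective_evalBidual
    (hb : ∀ C : Set X, IsVonNBounded 𝕜 C ↔ ∃ r > 0, ∀ x ∈ C, p x ≤ r)
    (hK : IsCompact (p.closedBall 0 1)) : Function.Surjective (evalBidual 𝕜 X) := by
  intro φ
  have hball := isVonNBounded_closedBall hb
  have hdual := (isNormInducing_dualSeminorm hb).isBdd_closedBall 1
  set M := dualSeminorm ((dualSeminorm (p.closedBall 0 1)).closedBall 0 1) φ + 1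
  have hM : 0 < M := add_pos_of_nonneg_of_pos (apply_nonneg _ φ) one_pos
  obtain ⟨x, -, hx⟩ := exists_mem_forall_apply_eq (absConvex_seminorm_closedBall p 1)
    ⟨0, p.mem_closedBall_self zero_le_one⟩ hK
    (φ := ((M⁻¹ : ℝ) : 𝕜) • (φ : StrongDual 𝕜 X →ₗ[𝕜] 𝕜)) fun ℓ hℓ => by
      have hℓ_mem : ℓ ∈ (dualSeminorm (p.closedBall 0 1)).closedBall 0 1 :=
        Seminorm.mem_closedBall_zero _ |>.2 (dualSeminorm_le hball zero_le_one hℓ)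
      have hφℓ : ‖φ ℓ‖ ≤ M :=
        (norm_le_dualSeminorm hdual φ hℓ_mem).trans (le_add_of_nonneg_right zero_le_one)
      rw [LinearMap.smul_apply, norm_smul, RCLike.norm_ofReal, abs_of_pos (inv_pos.2 hM),
        inv_mul_le_iff₀ hM, mul_one]
      exact hφℓ
  refine ⟨(M : 𝕜) • x, ?_⟩
  ext ℓ
  rw [evalBidual_apply, map_smul, ← hx ℓ, LinearMap.smul_apply, smul_smul, ← RCLike.ofReal_mul,
    mul_inv_cancel₀ hM.ne', RCLike.ofReal_one, one_smul]
  rfl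

end Bidual

variable {τ γ : TopologicalSpace X} {p : Seminorm 𝕜 X}

theorem exists_isTopIso_bidual (hp : IsNormInducing τ p) (hγ : IsLCH 𝕜 γ)
    (hb : SameBounded 𝕜 τ γ) (hK : @IsCompact X γ (p.closedBall 0 1)) :
    ∃ φ : X ≃ₗ[𝕜] StrongDual 𝕜 (StrongDual 𝕜 X), IsTopIso τ φ ∧ ∀ x ℓ, φ x ℓ = ℓ x := by
  have := hγ.continuousSMul
  have hpγ : ∀ C : Set X, IsVonNBounded 𝕜 C ↔ ∃ r > 0, ∀ x ∈ C, p x ≤ r :=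
    fun C => (hb C).symm.trans hp.isBdd_iff
  have hdual := isNormInducing_dualSeminorm hpγ
  have hbidual := isNormInducing_dualSeminorm fun _ => hdual.isBdd_iff
  have hnorm := dualSeminorm_evalBidual hγ hpγ (hγ.isClosed_closedBall hK one_pos)
  have hinj : Function.Injective (evalBidual 𝕜 X) :=
    (injective_iff_map_eq_zero _).2 fun x hx => hp.eq_zero x (by rw [← hnorm, hx, map_zero])
  let φ := LinearEquiv.ofBijective (evalBidual 𝕜 X) ⟨hinj, surjective_evalBidual hpγ hK⟩
  refine ⟨φ, ⟨?_, ?_⟩, fun _ _ => rfl⟩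
  · exact hp.continuous_of_le_mul hbidual (M := 1) (evalBidual 𝕜 X) fun x => by
      rw [hnorm, one_mul]
  · refine hbidual.continuous_of_le_mul hp (M := 1) φ.symm.toLinearMap fun ψ => ?_
    rw [← hnorm, one_mul]
    exact (congrArg _ (φ.apply_symm_apply ψ)).le

theorem semiMontel_of_isCompact (hp : IsNormInducing τ p) (hγ : IsLCH 𝕜 γ)
    (hb : SameBounded 𝕜 τ γ) (hK : @IsCompact X γ (p.closedBall 0 1)) : SemiMontel 𝕜 γ := by
  intro C hC
  obtain ⟨r, hr, hCr⟩ := hp.isBdd_iff.1 ((hb C).2 hC)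
  exact (hγ.isCompact_closedBall hK hr).of_isClosed_subset isClosed_closure
    (closure_minimal (fun x hx => p.mem_closedBall_zero.2 (hCr x hx))
      (hγ.isClosed_closedBall hK hr))

end Dual

section FunctionSpace

variable {𝕜 : Type v} [RCLike 𝕜] {Ω : Type u} (F : Submodule 𝕜 (Ω → 𝕜))

section PointwiseTopology

theorem continuous_pointEval (x : Ω) : Continuous[pointwiseTopology F, _] (pointEval F x) :=
  let := pointwiseTopology F
  (continuous_apply x).comp continuous_induced_dom

theorem isLCH_pointwiseTopology : IsLCH 𝕜 (pointwiseTopology F) where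
  polynormable := PolynormableSpace.induced F.subtype
  t2 :=
    let := pointwiseTopology F
    T2Space.of_injective_continuous (f := fun f : F => (f : Ω → 𝕜)) Subtype.val_injective
      continuous_induced_dom

variable {F} {C : Set F}

theorem isCompact_pointwiseTopology_iff :
    @IsCompact F (pointwiseTopology F) C ↔ IsCompact ((fun f : F => (f : Ω → 𝕜)) '' C) :=
  let := pointwiseTopology F
  (IsInducing.mk rfl).isCompact_iff

theorem isCompact_pointwiseTopology_of_continuousOn_pointEval {_ : TopologicalSpace F}
    (hcont : ∀ x, ContinuousOn (pointEval F x) C) (hC : IsCompact C) :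
    @IsCompact F (pointwiseTopology F) C :=
  isCompact_pointwiseTopology_iff.2 (hC.image_of_continuousOn (continuousOn_pi.2 hcont))

end PointwiseTopology

section Alaoglu

variable {Y : Type*} [AddCommGroup Y] [Module 𝕜 Y]

theorem isCompact_image_coe_linearMap_norm_le (m : Y → ℝ) :
    IsCompact ((fun (L : Y →ₗ[𝕜] 𝕜) y => L y) '' {L | ∀ y, ‖L y‖ ≤ m y}) := by
  have hpi : IsCompact (Set.univ.pi fun y => Metric.closedBall (0 : 𝕜) (m y)) :=
    isCompact_univ_pi fun y => isCompact_closedBall 0 (m y)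
  convert hpi.inter_left (LinearMap.isClosed_range_coe Y 𝕜 (RingHom.id 𝕜)) using 1
  ext φ
  constructor
  · rintro ⟨L, hL, rfl⟩
    exact ⟨Set.mem_range_self L, fun y _ => mem_closedBall_zero_iff.2 (hL y)⟩
  · rintro ⟨⟨L, rfl⟩, hL⟩
    exact ⟨L, fun y => mem_closedBall_zero_iff.1 (hL y trivial), rfl⟩

variable {F} {C : Set F}

theorem isCompact_pointwiseTopology_of_linearMap (m : Y → ℝ) (δ : Ω → Y)
    (hC : ∀ f ∈ C, ∃ L : Y →ₗ[𝕜] 𝕜, (∀ y, ‖L y‖ ≤ m y) ∧ ∀ x, L (δ x) = (f : Ω → 𝕜) x)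
    (hL : ∀ L : Y →ₗ[𝕜] 𝕜, (∀ y, ‖L y‖ ≤ m y) → ∃ f ∈ C, ∀ x, L (δ x) = (f : Ω → 𝕜) x) :
    @IsCompact F (pointwiseTopology F) C := by
  have hcont : Continuous fun (φ : Y → 𝕜) x => φ (δ x) :=
    continuous_pi fun x => continuous_apply (δ x)
  rw [isCompact_pointwiseTopology_iff]
  convert (isCompact_image_coe_linearMap_norm_le (𝕜 := 𝕜) m).image hcont using 1
  ext g
  constructor
  · rintro ⟨f, hf, rfl⟩
    obtain ⟨L, hLm, hLf⟩ := hC f hf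
    exact ⟨L, ⟨L, hLm, rfl⟩, funext hLf⟩
  · rintro ⟨_, ⟨L, hLm, rfl⟩, rfl⟩
    obtain ⟨f, hf, hLf⟩ := hL L hLm
    exact ⟨f, hf, funext fun x => (hLf x).symm⟩

end Alaoglu

section SemiReflexive

variable {F} {γ : TopologicalSpace F}

theorem SemiReflexive.isCompact_pointwiseTopology (hs : SemiReflexive 𝕜 γ) (hγ : IsLCH 𝕜 γ)
    (hle : γ ≤ pointwiseTopology F) {C : Set F} (hC : AbsConvex 𝕜 C) (hne : C.Nonempty)
    (hb : IsBdd 𝕜 γ C) (hcl : IsClosed C) : @IsCompact F (pointwiseTopology F) C := by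
  let δ : Ω → StrongDual 𝕜 F := fun x =>
    ⟨pointEval F x, continuous_le_dom hle (continuous_pointEval F x)⟩
  refine isCompact_pointwiseTopology_of_linearMap (dualSeminorm C) δ (fun f hf => ?_) fun L hL => ?_
  · exact ⟨(topDualPairing 𝕜 F).flip f, fun ℓ => norm_le_dualSeminorm hb ℓ hf, fun _ => rfl⟩
  · obtain ⟨f, hf⟩ := hs ⟨L, continuous_of_norm_le_dualSeminorm hb hL⟩
    have hLf : ∀ ℓ, L ℓ = ℓ f := hf
    refine ⟨f, ?_, fun x => hLf (δ x)⟩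
    by_contra hfC
    obtain ⟨ℓ, hℓC, hℓf⟩ := hγ.exists_norm_le_one_lt_norm hC hne hcl hfC
    rw [← hLf ℓ] at hℓf
    exact ((hL ℓ).trans (dualSeminorm_le hb zero_le_one hℓC)).not_gt hℓf

end SemiReflexive

section UnitBall

variable {F} {τ τ' : TopologicalSpace F} {p : Seminorm 𝕜 F}

theorem AdmitsStrongBanachLinearisation.exists_isCompact_closedBall
    (h : AdmitsStrongBanachLinearisation F τ) :
    ∃ p : Seminorm 𝕜 F, IsNormInducing τ p ∧
      @IsCompact F (pointwiseTopology F) (p.closedBall 0 1) := by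
  obtain ⟨Y, _, _, σ, -, ⟨q, hq, -⟩, δ, T, hT, hTδ⟩ := h
  have hball : IsVonNBounded 𝕜 (q.closedBall 0 1) := hq.isBdd_closedBall 1
  have hT_apply : ∀ f x, T f (δ x) = (f : Ω → 𝕜) x := fun f => congrFun (hTδ f)
  refine ⟨_, (isNormInducing_dualSeminorm fun _ => hq.isBdd_iff).comp_of_isTopIso hT,
    isCompact_pointwiseTopology_of_linearMap q δ (fun f hf => ?_) fun L hL => ?_⟩
  · have hTf : dualSeminorm (q.closedBall 0 1) (T f) ≤ 1 :=
      (Seminorm.mem_closedBall_zero (p := Seminorm.comp _ _)).1 hf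
    exact ⟨(T f : Y →ₗ[𝕜] 𝕜), fun y => (norm_le_dualSeminorm_mul hball (T f) y).trans
      (mul_le_of_le_one_left (apply_nonneg q y) hTf), hT_apply f⟩
  · have hcont : Continuous L :=
      hq.continuous_of_le_mul (isNormInducing_normSeminorm 𝕜) L (M := 1) fun y =>
        (hL y).trans_eq (one_mul _).symm
    obtain ⟨f, hf⟩ := T.surjective ⟨L, hcont⟩
    refine ⟨f, Seminorm.mem_closedBall_zero _ |>.2 ?_, fun x => ?_⟩
    · refine dualSeminorm_le hball zero_le_one fun y hy => ?_
      exact (congrArg (fun ℓ : StrongDual 𝕜 Y => ‖ℓ y‖) hf).trans_le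
        ((hL y).trans (q.mem_closedBall_zero.1 hy))
    · rw [← hT_apply, hf]
      rfl

theorem HasSemiMontelPrebidualWithEvaluations.admitsStrongBanachLinearisation
    (h : HasSemiMontelPrebidualWithEvaluations F τ) : AdmitsStrongBanachLinearisation F τ := by
  obtain ⟨Y, _, _, σ, -, -, ⟨q, hq, hcomplete⟩, φ, hφ, heval⟩ := h
  choose y hy using fun x => (heval x).exists
  exact ⟨StrongDual 𝕜 Y, inferInstance, inferInstance, inferInstance, hq.isLCH, ⟨q, hq, hcomplete⟩,
    y, φ, hφ, fun f => funext fun x => (hy x f).symm⟩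

theorem BBC.exists_isCompact_closedBall (h : BBC 𝕜 τ τ') (hp : IsNormInducing τ p)
    (hle : τ' ≤ pointwiseTopology F) :
    ∃ q : Seminorm 𝕜 F, IsNormInducing τ q ∧
      @IsCompact F (pointwiseTopology F) (q.closedBall 0 1) := by
  obtain ⟨C, hsub, hC, hb, hcomp⟩ := h _ (hp.isBdd_closedBall 1)
  have hlch := isLCH_pointwiseTopology F
  have hcomp' := isCompact_pointwiseTopology_of_continuousOn_pointEval
    (fun x => (continuous_le_dom hle (continuous_pointEval F x)).continuousOn) hcomp
  have := hlch.t2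
  obtain ⟨q, hq, rfl⟩ := hp.exists_closedBall_eq hlch hC hb hsub
    (@IsCompact.isClosed F (pointwiseTopology F) _ _ hcomp')
  exact ⟨q, hq, hcomp'⟩

theorem BBCl.exists_isCompact_closedBall (h : BBCl 𝕜 τ τ') (hp : IsNormInducing τ p)
    (hτ' : IsLCH 𝕜 τ') (hle : τ' ≤ pointwiseTopology F) (hle' : τ ≤ τ')
    (hs : SemiReflexive 𝕜 (mixedTopology 𝕜 τ τ')) :
    ∃ q : Seminorm 𝕜 F, IsNormInducing τ q ∧
      @IsCompact F (pointwiseTopology F) (q.closedBall 0 1) := by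
  obtain ⟨C, hsub, hC, hb, hcl⟩ := h _ (hp.isBdd_closedBall 1)
  obtain ⟨q, hq, rfl⟩ := hp.exists_closedBall_eq hτ' hC hb hsub hcl
  have hB := exists_isMixedBasis hq hτ' hcl
  have hγ := mixedTopology_le hp.isLCH hτ' hB
  exact ⟨q, hq, hs.isCompact_pointwiseTopology (isLCH_mixedTopology hp.isLCH hτ' hB)
    (hγ.trans hle) hC ⟨0, q.mem_closedBall_self zero_le_one⟩
    (hb.of_topologicalSpace_le (le_mixedTopology hq hτ' hle' hB)) (hcl.mono hγ)⟩

end UnitBall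

section Compact

variable {F} {τ : TopologicalSpace F} {p : Seminorm 𝕜 F}

theorem le_pointwiseTopology_of_isCompact (hp : IsNormInducing τ p)
    (hK : @IsCompact F (pointwiseTopology F) (p.closedBall 0 1)) : τ ≤ pointwiseTopology F := by
  refine continuous_iff_le_induced.1 (@continuous_pi F Ω _ τ _ _ fun x => ?_)
  obtain ⟨M, hM⟩ := isBounded_iff_forall_norm_le.1
    (@IsCompact.image F 𝕜 (pointwiseTopology F) _ _ _ hK (continuous_pointEval F x)).isBounded
  exact hp.continuous_of_le_mul (isNormInducing_normSeminorm 𝕜) (pointEval F x) <|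
    seminorm_le_mul_of_closedBall (q := (normSeminorm 𝕜 𝕜).comp (pointEval F x))
      fun f hf => hM _ (Set.mem_image_of_mem _ hf)

theorem sameBounded_of_isCompact (hp : IsNormInducing τ p)
    (hK : @IsCompact F (pointwiseTopology F) (p.closedBall 0 1)) :
    SameBounded 𝕜 τ (mixedTopology 𝕜 τ (pointwiseTopology F)) :=
  sameBounded_mixedTopology hp (isLCH_pointwiseTopology F) (le_pointwiseTopology_of_isCompact hp hK)
    ((isLCH_pointwiseTopology F).isClosed_closedBall hK one_pos)

theorem semiReflexive_of_isCompact (hp : IsNormInducing τ p)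
    (hK : @IsCompact F (pointwiseTopology F) (p.closedBall 0 1)) :
    SemiReflexive 𝕜 (mixedTopology 𝕜 τ (pointwiseTopology F)) := by
  have hlch := isLCH_pointwiseTopology F
  have hB := exists_isMixedBasis hp hlch (hlch.isClosed_closedBall hK one_pos)
  obtain ⟨φ, -, hφ⟩ := exists_isTopIso_bidual hp (isLCH_mixedTopology hp.isLCH hlch hB)
    (sameBounded_of_isCompact hp hK)
    (isCompact_mixedTopology hp.isLCH hlch hB (hp.isBdd_closedBall 1) hK)
  intro ψ
  obtain ⟨f, rfl⟩ := φ.surjective ψ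
  exact ⟨f, hφ f⟩

theorem hasSemiMontelPrebidual_of_isCompact (hp : IsNormInducing τ p)
    (hK : @IsCompact F (pointwiseTopology F) (p.closedBall 0 1)) :
    HasSemiMontelPrebidualWithEvaluations F τ := by
  have hlch := isLCH_pointwiseTopology F
  have hB := exists_isMixedBasis hp hlch (hlch.isClosed_closedBall hK one_pos)
  have hle := mixedTopology_le hp.isLCH hlch hB
  have hγ := isLCH_mixedTopology hp.isLCH hlch hB
  have hKγ := isCompact_mixedTopology hp.isLCH hlch hB (hp.isBdd_closedBall 1) hK
  have hb := sameBounded_of_isCompact hp hK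
  let γ := mixedTopology 𝕜 τ (pointwiseTopology F)
  obtain ⟨φ, hφ, hφ_apply⟩ := exists_isTopIso_bidual hp hγ hb hKγ
  refine ⟨F, inferInstance, inferInstance, γ, hγ, semiMontel_of_isCompact hp hγ hb hKγ, ?_, φ, hφ,
    fun x => ?_⟩
  · exact completelyNormable_strongDual (fun C => (hb C).symm.trans hp.isBdd_iff)
      fun ℓ hℓ => continuous_mixedTopology_of_memBddDual hp.isLCH hlch hB <|
        memBddDual_of_memBddDual_mixedTopology hp.isLCH hlch hB fun C hC => hℓ C ((hb C).1 hC)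
  · let δx : StrongDual 𝕜 F := ⟨pointEval F x, continuous_le_dom hle (continuous_pointEval F x)⟩
    exact ⟨δx, fun f => (hφ_apply f δx).symm, fun ℓ hℓ =>
      ContinuousLinearMap.ext fun f => (hφ_apply f ℓ).symm.trans (hℓ f).symm⟩

end Compact

end FunctionSpace

end Linearisation

open Linearisation in
theorem mainTheorem6_general {𝕜 : Type*} [RCLike 𝕜] {Ω : Type*} (F : Submodule 𝕜 (Ω → 𝕜))
    (τ : TopologicalSpace F) :
    [ AdmitsStrongBanachLinearisation F τ,
      HasSemiMontelPrebidualWithEvaluations F τ,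
      CompletelyNormable 𝕜 τ ∧
        ∃ τ' : TopologicalSpace F, IsLCH 𝕜 τ' ∧
          τ' ≤ pointwiseTopology F ∧
          BBC 𝕜 τ τ' ∧ CNC 𝕜 τ τ' ∧
          SameBounded 𝕜 τ (mixedTopology 𝕜 τ τ'),
      CompletelyNormable 𝕜 τ ∧
        ∃ τ' : TopologicalSpace F, IsLCH 𝕜 τ' ∧
          τ' ≤ pointwiseTopology F ∧ τ ≤ τ' ∧
          BBCl 𝕜 τ τ' ∧
          SemiReflexive 𝕜 (mixedTopology 𝕜 τ τ'),
      CompletelyNormable 𝕜 τ ∧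
        ∃ τ' : TopologicalSpace F, IsLCH 𝕜 τ' ∧
          τ' ≤ pointwiseTopology F ∧ BBC 𝕜 τ τ',
      ∃ p : Seminorm 𝕜 F, IsNormInducing τ p ∧
        ∃ τ' : TopologicalSpace F, IsLCH 𝕜 τ' ∧
          τ' ≤ pointwiseTopology F ∧ @IsCompact F τ' (p.closedBall 0 1),
      ∃ p : Seminorm 𝕜 F, IsNormInducing τ p ∧
        ∃ τ' : TopologicalSpace F, IsLCH 𝕜 τ' ∧
          (∀ x : Ω, MemBddDual 𝕜 τ τ' (pointEval F x)) ∧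
          @IsCompact F τ' (p.closedBall 0 1),
      CompletelyNormable 𝕜 τ ∧
        BBC 𝕜 τ (pointwiseTopology F),
      ∃ p : Seminorm 𝕜 F, IsNormInducing τ p ∧
        @IsCompact F (pointwiseTopology F) (p.closedBall 0 1) ].TFAE := by
  have hlch := isLCH_pointwiseTopology F
  tfae_have 1 → 9 := fun h => h.exists_isCompact_closedBall
  tfae_have 9 → 2 := fun ⟨_, hp, hK⟩ => hasSemiMontelPrebidual_of_isCompact hp hK
  tfae_have 2 → 1 := fun h => h.admitsStrongBanachLinearisation
  tfae_have 9 → 3 := fun ⟨_, hp, hK⟩ =>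
    ⟨completelyNormable_of_isCompact hp hlch hK, _, hlch, le_rfl, bbc_of_isCompact hp hlch hK,
      cnc_of_isCompact hp hlch hK, sameBounded_of_isCompact hp hK⟩
  tfae_have 3 → 5 := fun ⟨h, τ', hτ', hle, hbbc, _⟩ => ⟨h, τ', hτ', hle, hbbc⟩
  tfae_have 5 → 9 := fun ⟨⟨_, hp, _⟩, _, _, hle, hbbc⟩ => hbbc.exists_isCompact_closedBall hp hle
  tfae_have 9 → 4 := fun ⟨_, hp, hK⟩ =>
    ⟨completelyNormable_of_isCompact hp hlch hK, _, hlch, le_rfl,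
      le_pointwiseTopology_of_isCompact hp hK, (bbc_of_isCompact hp hlch hK).bbcl hlch.t2,
      semiReflexive_of_isCompact hp hK⟩
  tfae_have 4 → 9 := fun ⟨⟨_, hp, _⟩, _, hτ', hle, hle', hbbcl, hs⟩ =>
    hbbcl.exists_isCompact_closedBall hp hτ' hle hle' hs
  tfae_have 9 → 8 := fun ⟨_, hp, hK⟩ =>
    ⟨completelyNormable_of_isCompact hp hlch hK, bbc_of_isCompact hp hlch hK⟩
  tfae_have 8 → 5 := fun ⟨h, hbbc⟩ => ⟨h, _, hlch, le_rfl, hbbc⟩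
  tfae_have 9 → 6 := fun ⟨p, hp, hK⟩ => ⟨p, hp, _, hlch, le_rfl, hK⟩
  tfae_have 6 → 7 := fun ⟨p, hp, τ', hτ', hle, hK⟩ => ⟨p, hp, τ', hτ', fun x _ _ =>
    (continuous_le_dom hle (continuous_pointEval F x)).continuousOn, hK⟩
  tfae_have 7 → 9 := fun ⟨p, hp, _, _, hmem, hK⟩ =>
    ⟨p, hp, isCompact_pointwiseTopology_of_continuousOn_pointEval
      (fun x => hmem x _ (hp.isBdd_closedBall 1)) hK⟩
  tfae_finish

theorem mainTheorem6 {𝕜 : Type*} [RCLike 𝕜] {Ω : Type*} [Nonempty Ω]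
    (F : Submodule 𝕜 (Ω → 𝕜)) (τ : TopologicalSpace F)
    (hτ : Linearisation.IsLCH 𝕜 τ) (hborn : Linearisation.IsBornologicalSpace 𝕜 τ) :
    [ -- (a)
      Linearisation.AdmitsStrongBanachLinearisation F τ,
      -- (b)
      Linearisation.HasSemiMontelPrebidualWithEvaluations F τ,
      -- (c)
      Linearisation.CompletelyNormable 𝕜 τ ∧
        ∃ τ' : TopologicalSpace F, Linearisation.IsLCH 𝕜 τ' ∧
          τ' ≤ Linearisation.pointwiseTopology F ∧
          Linearisation.BBC 𝕜 τ τ' ∧ Linearisation.CNC 𝕜 τ τ' ∧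
          Linearisation.SameBounded 𝕜 τ (Linearisation.mixedTopology 𝕜 τ τ'),
      -- (d)
      Linearisation.CompletelyNormable 𝕜 τ ∧
        ∃ τ' : TopologicalSpace F, Linearisation.IsLCH 𝕜 τ' ∧
          τ' ≤ Linearisation.pointwiseTopology F ∧ τ ≤ τ' ∧
          Linearisation.BBCl 𝕜 τ τ' ∧
          Linearisation.SemiReflexive 𝕜 (Linearisation.mixedTopology 𝕜 τ τ'),
      -- (e)
      Linearisation.CompletelyNormable 𝕜 τ ∧
        ∃ τ' : TopologicalSpace F, Linearisation.IsLCH 𝕜 τ' ∧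
          τ' ≤ Linearisation.pointwiseTopology F ∧ Linearisation.BBC 𝕜 τ τ',
      -- (f)
      ∃ p : Seminorm 𝕜 F, Linearisation.IsNormInducing τ p ∧
        ∃ τ' : TopologicalSpace F, Linearisation.IsLCH 𝕜 τ' ∧
          τ' ≤ Linearisation.pointwiseTopology F ∧ @IsCompact F τ' (p.closedBall 0 1),
      -- (g)
      ∃ p : Seminorm 𝕜 F, Linearisation.IsNormInducing τ p ∧
        ∃ τ' : TopologicalSpace F, Linearisation.IsLCH 𝕜 τ' ∧
          (∀ x : Ω, Linearisation.MemBddDual 𝕜 τ τ' (Linearisation.pointEval F x)) ∧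
          @IsCompact F τ' (p.closedBall 0 1),
      -- (h)
      Linearisation.CompletelyNormable 𝕜 τ ∧
        Linearisation.BBC 𝕜 τ (Linearisation.pointwiseTopology F),
      -- (i)
      ∃ p : Seminorm 𝕜 F, Linearisation.IsNormInducing τ p ∧
        @IsCompact F (Linearisation.pointwiseTopology F) (p.closedBall 0 1) ].TFAE :=
  mainTheorem6_general F τ
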